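/- Let $X,Y$ be (real or complex) Banach spaces and $T:X\to Y$ a bounded linear operator. Regard every Banach space $Z$ as a subspace of $Z^{**}$ through the canonical embedding; for a subspace $M\subset Z$ put $M^\perp=\{z^*\in Z^*: z^*(m)=0\text{ for all }m\in M\}$. Thus $X^\perp\subset X^{***}$, $Y^\perp\subset Y^{***}$ and $(X^{*})^{\perp}\subset X^{****}$. An (into) isomorphism is a bounded linear operator which is a homeomorphism onto its range. Let $\pi$ denote the quotient maps $X^{**}\to X^{**}/X$ and $Y^{**}\to Y^{**}/Y$, and let $\widetilde T:X^{**}/X\to Y^{**}/Y$ be the induced operator $\widetilde T(\pi x^{**})=\pi(T^{**}x^{**})$. The operator $T$ is called strongly Tauberian if $\widetilde T$ is an (into) isomorphism. For $\lambda>0$, an infinite sequence $(b_j)_{j\ge1}$ in a Banach space is called $\lambda$-wide-$(s)$ if (a) $(b_j)$ is a $2\lambda$-basic sequence, i.e. it is a Schauder basis of its closed linear span and $\|\sum_{j=1}^k c_jb_j\|\le 2\lambda\,\|\sum_{j=1}^\infty c_jb_j\|$ for all $k$ and all scalars $c_1,c_2,\dots$ such that $\sum c_jb_j$ converges; (b)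 $\|b_j\|\le\lambda$ for all $j$; (c) $|\sum_{j=k}^n c_j|\le\lambda\,\|\sum_{j=1}^n c_jb_j\|$ for all $1\le k\le n<\infty$ and all scalars $c_1,\dots,c_n$. Then the following are equivalent: 1) $T$ is strongly Tauberian. 2) There is a $\delta>0$ such that $\operatorname{dist}(T^{**}x^{**},Y)\ge\delta\operatorname{dist}(x^{**},X)$ for all $x^{**}\in X^{**}$. 3) $T^{***}(Y^\perp)=X^\perp$. 4) The restriction of $T^{****}$ to $(X^{*})^{\perp}$, as an operator into $Y^{****}$, is an (into) isomorphism. 5) $T^{**}:X^{**}\to Y^{**}$ is strongly Tauberian. 6) For every $\lambda>1$ there exists $\beta>1$ such that every infinite $\lambda$-wide-$(s)$ sequence $(x_j)$ in $X$ has a subsequence $(x_{j_i})$ for which $(Tx_{j_i})$ is a $\beta$-wide-$(s)$ sequence in $Y$. 7) There exist $\lambda>1$ and $\beta>1$ such that every infinite $\lambda$-wide-$(s)$ sequence $(x_j)$ in $X$ has a subsequence $(x_{j_i})$ for which $(Tx_{j_i})$ is a $\beta$-wide-$(s)$ sequence in $Y$. -/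

import Mathlib

open Topology Filter NormedSpace

noncomputable section

namespace StronglyTauberian

section DualSpace

variable (𝕜 : Type*) [RCLike 𝕜] (E : Type*) [NormedAddCommGroup E] [NormedSpace 𝕜 E]

/-- The dual `E*` of a normed space. It is Mathlib's `StrongDual 𝕜 E` with the operator norm; the
separate name is only there to keep instance search working on iterated duals. -/
def Dual : Type _ := StrongDual 𝕜 E

instance : NormedAddCommGroup (Dual 𝕜 E) := inferInstanceAs (NormedAddCommGroup (StrongDual 𝕜 E))

instance : NormedSpace 𝕜 (Dual 𝕜 E) := inferInstanceAs (NormedSpace 𝕜 (StrongDual 𝕜 E))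

instance : CompleteSpace (Dual 𝕜 E) := inferInstanceAs (CompleteSpace (StrongDual 𝕜 E))

instance : FunLike (Dual 𝕜 E) E 𝕜 := inferInstanceAs (FunLike (StrongDual 𝕜 E) E 𝕜)

instance : ContinuousLinearMapClass (Dual 𝕜 E) 𝕜 E 𝕜 :=
  inferInstanceAs (ContinuousLinearMapClass (StrongDual 𝕜 E) 𝕜 E 𝕜)

/-- The identification of `Dual 𝕜 E` with `StrongDual 𝕜 E`. -/
def Dual.toStrongDual : Dual 𝕜 E ≃ₗᵢ[𝕜] StrongDual 𝕜 E :=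
  LinearIsometryEquiv.refl 𝕜 (StrongDual 𝕜 E)

variable {𝕜 E}

theorem Dual.toStrongDual_apply (f : Dual 𝕜 E) (x : E) : Dual.toStrongDual 𝕜 E f x = f x := rfl

theorem Dual.norm_toStrongDual (f : Dual 𝕜 E) : ‖Dual.toStrongDual 𝕜 E f‖ = ‖f‖ := rfl

theorem Dual.add_apply (f g : Dual 𝕜 E) (x : E) : (f + g) x = f x + g x := rfl

theorem Dual.smul_apply (a : 𝕜) (f : Dual 𝕜 E) (x : E) : (a • f) x = a • f x := rfl

theorem Dual.zero_apply (x : E) : (0 : Dual 𝕜 E) x = 0 := rfl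

end DualSpace

section Operators

variable (𝕜 : Type*) [RCLike 𝕜]

/-- The canonical embedding `X → X**`, `x ↦ (f ↦ f x)`. -/
def toBidual (X : Type*) [NormedAddCommGroup X] [NormedSpace 𝕜 X] :
    X →L[𝕜] Dual 𝕜 (Dual 𝕜 X) :=
  inclusionInDoubleDual 𝕜 X

theorem toBidual_apply {X : Type*} [NormedAddCommGroup X] [NormedSpace 𝕜 X]
    (x : X) (f : Dual 𝕜 X) : toBidual 𝕜 X x f = f x := rfl

/-- The canonical image of `X` in its bidual `X**`, as a linear subspace of `X**`. -/
def canonicalImage (X : Type*) [NormedAddCommGroup X] [NormedSpace 𝕜 X] :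
    Submodule 𝕜 (Dual 𝕜 (Dual 𝕜 X)) :=
  (toBidual 𝕜 X).range

/-- The annihilator `M^⊥ = {f ∈ E* : f x = 0 for all x ∈ M}` of a linear subspace `M` of `E`. -/
def annihilator {E : Type*} [NormedAddCommGroup E] [NormedSpace 𝕜 E] (M : Submodule 𝕜 E) :
    Submodule 𝕜 (Dual 𝕜 E) where
  carrier := {f | ∀ x ∈ M, f x = 0}
  zero_mem' := fun _ _ => rfl
  add_mem' := fun hf hg x hx => by rw [Dual.add_apply, hf x hx, hg x hx, add_zero]
  smul_mem' := fun a f hf x hx => by rw [Dual.smul_apply, hf x hx, smul_zero]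

variable {𝕜}
variable {X Y : Type*} [NormedAddCommGroup X] [NormedSpace 𝕜 X]
  [NormedAddCommGroup Y] [NormedSpace 𝕜 Y]

/-- The Banach space adjoint `T* : Y* → X*`, `T* f = f ∘ T`. -/
def adj (T : X →L[𝕜] Y) : Dual 𝕜 Y →L[𝕜] Dual 𝕜 X :=
  T.precomp 𝕜

theorem adj_apply (T : X →L[𝕜] Y) (f : Dual 𝕜 Y) (x : X) : adj T f x = f (T x) := rfl

/-- `T** : X** → Y**`. -/
abbrev adj2 (T : X →L[𝕜] Y) : Dual 𝕜 (Dual 𝕜 X) →L[𝕜] Dual 𝕜 (Dual 𝕜 Y) :=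
  adj (adj T)

/-- `T*** : Y*** → X***`. -/
abbrev adj3 (T : X →L[𝕜] Y) :
    Dual 𝕜 (Dual 𝕜 (Dual 𝕜 Y)) →L[𝕜] Dual 𝕜 (Dual 𝕜 (Dual 𝕜 X)) :=
  adj (adj2 T)

/-- `T**** : X**** → Y****`. -/
abbrev adj4 (T : X →L[𝕜] Y) :
    Dual 𝕜 (Dual 𝕜 (Dual 𝕜 (Dual 𝕜 X))) →L[𝕜] Dual 𝕜 (Dual 𝕜 (Dual 𝕜 (Dual 𝕜 Y))) :=
  adj (adj3 T)

/-- An (into) isomorphism: a bounded linear operator that is a homeomorphism onto its range. -/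
def IsIntoIsomorphism {E F : Type*} [AddCommGroup E] [Module 𝕜 E] [TopologicalSpace E]
    [AddCommGroup F] [Module 𝕜 F] [TopologicalSpace F] (S : E →L[𝕜] F) : Prop :=
  IsEmbedding S

theorem adj2_toBidual (T : X →L[𝕜] Y) (x : X) :
    adj2 T (toBidual 𝕜 X x) = toBidual 𝕜 Y (T x) := rfl

theorem canonicalImage_le_ker (T : X →L[𝕜] Y) :
    canonicalImage 𝕜 X ≤ ((canonicalImage 𝕜 Y).mkQL ∘L adj2 T).ker := by
  rintro _ ⟨x, rfl⟩
  exact (Submodule.Quotient.mk_eq_zero _).2 ⟨T x, rfl⟩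

/-- The operator `X**/X → Y**/Y` induced by `T`, sending `π x**` to `π (T** x**)`. -/
def inducedOperator (T : X →L[𝕜] Y) :
    (Dual 𝕜 (Dual 𝕜 X) ⧸ canonicalImage 𝕜 X) →L[𝕜]
      (Dual 𝕜 (Dual 𝕜 Y) ⧸ canonicalImage 𝕜 Y) :=
  (canonicalImage 𝕜 X).liftQL ((canonicalImage 𝕜 Y).mkQL ∘L adj2 T) (canonicalImage_le_ker T)

/-- `T` is strongly Tauberian if the induced operator `X**/X → Y**/Y` is an into isomorphism. -/
def IsStronglyTauberian (T : X →L[𝕜] Y) : Prop :=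
  IsIntoIsomorphism (inducedOperator T)

end Operators

section Sequences

variable (𝕜 : Type*) [RCLike 𝕜] {X : Type*} [NormedAddCommGroup X] [NormedSpace 𝕜 X]

/-- A basic sequence: a Schauder basis of its closed linear span. -/
def IsBasicSequence (b : ℕ → X) : Prop :=
  ∃ B : SchauderBasis 𝕜 (Submodule.span 𝕜 (Set.range b)).topologicalClosure,
    ∀ n, (B n : X) = b n

/-- A `K`-basic sequence: a basic sequence such that every partial sum of a convergent series
`x = ∑ c j • b j` has norm at most `K * ‖x‖`. -/
def IsKBasic (K : ℝ) (b : ℕ → X) : Prop :=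
  IsBasicSequence 𝕜 b ∧
    ∀ (c : ℕ → 𝕜) (x : X), Tendsto (fun n => ∑ j ∈ Finset.range n, c j • b j) atTop (𝓝 x) →
      ∀ k, ‖∑ j ∈ Finset.range k, c j • b j‖ ≤ K * ‖x‖

/-- An infinite `lam`-wide-(s) sequence. -/
structure IsWideS (lam : ℝ) (b : ℕ → X) : Prop where
  isKBasic : IsKBasic 𝕜 (2 * lam) b
  norm_le : ∀ j, ‖b j‖ ≤ lam
  norm_sum_le : ∀ (k n : ℕ), k ≤ n → ∀ c : ℕ → 𝕜,
    ‖∑ j ∈ Finset.Icc k n, c j‖ ≤ lam * ‖∑ j ∈ Finset.range (n + 1), c j • b j‖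

/-- Every infinite `lam`-wide-(s) sequence in `X` has a subsequence which `T` maps to a
`bet`-wide-(s) sequence. -/
def MapsWideS {Y : Type*} [NormedAddCommGroup Y] [NormedSpace 𝕜 Y]
    (T : X →L[𝕜] Y) (lam bet : ℝ) : Prop :=
  ∀ x : ℕ → X, IsWideS 𝕜 lam x →
    ∃ φ : ℕ → ℕ, StrictMono φ ∧ IsWideS 𝕜 bet (fun j => T (x (φ j)))

end Sequences

end StronglyTauberian

end

noncomputable section

namespace StronglyTauberian

section IntoIsomorphism

variable {𝕜 : Type*} [RCLike 𝕜]

theorem exists_bound_of_isInducing {E F : Type*} [SeminormedAddCommGroup E] [NormedSpace 𝕜 E]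
    [SeminormedAddCommGroup F] [NormedSpace 𝕜 F] (S : E →L[𝕜] F) (hS : IsInducing S) :
    ∃ δ : ℝ, 0 < δ ∧ ∀ z, δ * ‖z‖ ≤ ‖S z‖ := by
  have h1 : Metric.ball (0 : E) 1 ∈ comap S (𝓝 (S 0)) := by
    rw [← hS.nhds_eq_comap]; exact Metric.ball_mem_nhds _ one_pos
  rw [map_zero] at h1
  obtain ⟨ε, hε, hb⟩ := (Metric.nhds_basis_ball.comap S).mem_iff.1 h1
  refine ⟨ε / 2, by positivity, fun z => ?_⟩
  by_contra! hz
  have hz0 : 0 < ‖z‖ := by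
    by_contra! h
    have : ‖z‖ = 0 := le_antisymm h (norm_nonneg _)
    rw [this, mul_zero] at hz
    exact absurd hz (norm_nonneg _).not_gt
  have h2 : ((‖z‖⁻¹ : ℝ) : 𝕜) • z ∈ Metric.ball (0 : E) 1 := by
    apply hb
    rw [Set.mem_preimage, mem_ball_zero_iff, map_smul, norm_smul, RCLike.norm_ofReal,
      abs_of_pos (inv_pos.2 hz0), inv_mul_lt_iff₀ hz0]
    nlinarith
  rw [mem_ball_zero_iff, norm_smul, RCLike.norm_ofReal, abs_of_pos (inv_pos.2 hz0),
    inv_mul_cancel₀ hz0.ne'] at h2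
  exact lt_irrefl _ h2

theorem isIntoIsomorphism_iff {E F : Type*} [NormedAddCommGroup E] [NormedSpace 𝕜 E]
    [SeminormedAddCommGroup F] [NormedSpace 𝕜 F] (S : E →L[𝕜] F) :
    IsIntoIsomorphism S ↔ ∃ δ : ℝ, 0 < δ ∧ ∀ z, δ * ‖z‖ ≤ ‖S z‖ := by
  refine ⟨fun h => exists_bound_of_isInducing S h.1, ?_⟩
  rintro ⟨δ, hδ, h⟩
  have ha : AntilipschitzWith (Real.toNNReal δ⁻¹) S :=
    AddMonoidHomClass.antilipschitz_of_bound S fun z => by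
      rw [Real.coe_toNNReal _ (inv_nonneg.2 hδ.le), le_inv_mul_iff₀ hδ]
      exact h z
  exact (ha.isUniformEmbedding S.uniformContinuous).isEmbedding

end IntoIsomorphism

section Annihilators

variable {𝕜 : Type*} [RCLike 𝕜] {E : Type*} [NormedAddCommGroup E] [NormedSpace 𝕜 E]

theorem mem_annihilator {M : Submodule 𝕜 E} {f : Dual 𝕜 E} :
    f ∈ annihilator 𝕜 M ↔ ∀ x ∈ M, f x = 0 := Iff.rfl

theorem mem_annihilator_canonicalImage {f : Dual 𝕜 (Dual 𝕜 (Dual 𝕜 E))} :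
    f ∈ annihilator 𝕜 (canonicalImage 𝕜 E) ↔ ∀ x, f (toBidual 𝕜 E x) = 0 :=
  ⟨fun h x => h _ ⟨x, rfl⟩, by rintro h _ ⟨x, rfl⟩; exact h x⟩

theorem Dual.le_norm (f : Dual 𝕜 E) (x : E) : ‖f x‖ ≤ ‖f‖ * ‖x‖ :=
  ContinuousLinearMap.le_opNorm (Dual.toStrongDual 𝕜 E f) x

theorem Dual.norm_le_of_bound (f : Dual 𝕜 E) {C : ℝ} (hC : 0 ≤ C) (h : ∀ x, ‖f x‖ ≤ C * ‖x‖) :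
    ‖f‖ ≤ C :=
  ContinuousLinearMap.opNorm_le_bound (Dual.toStrongDual 𝕜 E f) hC h

theorem norm_mk_eq_infDist (M : Submodule 𝕜 E) (x : E) :
    ‖(Submodule.Quotient.mk x : E ⧸ M)‖ = Metric.infDist x M :=
  QuotientAddGroup.norm_mk (S := M.toAddSubgroup) x

theorem norm_toBidual (x : E) : ‖toBidual 𝕜 E x‖ = ‖x‖ :=
  (inclusionInDoubleDualLi 𝕜 (E := E)).norm_map x

theorem exists_annihilator_apply_eq (M : Submodule 𝕜 E) (x : E) :
    ∃ f ∈ annihilator 𝕜 M, ‖f‖ ≤ 1 ∧ f x = (Metric.infDist x M : ℝ) := by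
  obtain ⟨g, hg, hgx⟩ := exists_dual_vector'' 𝕜 (Submodule.Quotient.mk x : E ⧸ M)
  refine ⟨(g ∘L M.mkQL : StrongDual 𝕜 E), fun y hy => ?_, ?_, ?_⟩
  · change g (Submodule.Quotient.mk y) = 0
    rw [(Submodule.Quotient.mk_eq_zero M).2 hy, map_zero]
  · refine Dual.norm_le_of_bound _ zero_le_one fun y => ?_
    refine (g.le_opNorm _).trans ?_
    exact mul_le_mul hg (Submodule.Quotient.norm_mk_le M y) (norm_nonneg _) zero_le_one
  · exact hgx.trans (by rw [norm_mk_eq_infDist])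

theorem norm_apply_le_infDist {M : Submodule 𝕜 E} {f : Dual 𝕜 E} (hf : f ∈ annihilator 𝕜 M)
    (x : E) : ‖f x‖ ≤ ‖f‖ * Metric.infDist x M := by
  rcases (norm_nonneg f).eq_or_lt with h0 | h0
  · simpa [← h0] using f.le_norm x
  rw [← div_le_iff₀' h0]
  refine (Metric.le_infDist ⟨0, M.zero_mem⟩).2 fun y hy => ?_
  rw [div_le_iff₀' h0, dist_eq_norm]
  simpa [map_sub, hf y hy] using f.le_norm (x - y)

theorem isClosed_canonicalImage [CompleteSpace E] :
    IsClosed (canonicalImage 𝕜 E : Set (Dual 𝕜 (Dual 𝕜 E))) :=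
  (inclusionInDoubleDualLi 𝕜 (E := E)).isometry.isClosedEmbedding.isClosed_range

theorem isClosed_annihilator (M : Submodule 𝕜 E) :
    IsClosed (annihilator 𝕜 M : Set (Dual 𝕜 E)) := by
  have : (annihilator 𝕜 M : Set (Dual 𝕜 E)) = ⋂ x ∈ M, {f : Dual 𝕜 E | f x = 0} := by
    ext f; simp [mem_annihilator]
  rw [this]
  exact isClosed_biInter fun x _ => isClosed_eq (toBidual 𝕜 E x).continuous continuous_const

end Annihilators

section Characterizations

variable {𝕜 : Type*} [RCLike 𝕜]
variable {X : Type*} [NormedAddCommGroup X] [NormedSpace 𝕜 X]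
variable {Y : Type*} [NormedAddCommGroup Y] [NormedSpace 𝕜 Y]

/-- The estimate `δ * dist (x**, X) ≤ dist (T** x**, Y)`. -/
def DistBound (T : X →L[𝕜] Y) (δ : ℝ) : Prop :=
  ∀ x : Dual 𝕜 (Dual 𝕜 X), δ * Metric.infDist x (canonicalImage 𝕜 X) ≤
    Metric.infDist (adj2 T x) (canonicalImage 𝕜 Y)

theorem inducedOperator_mk (T : X →L[𝕜] Y) (x : Dual 𝕜 (Dual 𝕜 X)) :
    inducedOperator T (Submodule.Quotient.mk x) = Submodule.Quotient.mk (adj2 T x) := rfl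

theorem isStronglyTauberian_iff [CompleteSpace X] (T : X →L[𝕜] Y) :
    IsStronglyTauberian T ↔ ∃ δ : ℝ, 0 < δ ∧ DistBound T δ := by
  have : IsClosed (canonicalImage 𝕜 X : Set (Dual 𝕜 (Dual 𝕜 X))) := isClosed_canonicalImage
  refine (isIntoIsomorphism_iff (inducedOperator T)).trans ?_
  refine exists_congr fun δ => and_congr_right fun _ => ?_
  refine ⟨fun h x => ?_, fun h z => ?_⟩
  · have := h (Submodule.Quotient.mk x)
    rwa [inducedOperator_mk, norm_mk_eq_infDist, norm_mk_eq_infDist] at this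
  · obtain ⟨x, rfl⟩ := Submodule.Quotient.mk_surjective _ z
    rw [inducedOperator_mk, norm_mk_eq_infDist, norm_mk_eq_infDist]
    exact h x

theorem adj3_mem_annihilator (T : X →L[𝕜] Y) {g : Dual 𝕜 (Dual 𝕜 (Dual 𝕜 Y))}
    (hg : g ∈ annihilator 𝕜 (canonicalImage 𝕜 Y)) :
    adj3 T g ∈ annihilator 𝕜 (canonicalImage 𝕜 X) := by
  rw [mem_annihilator_canonicalImage] at hg ⊢
  intro x
  rw [adj_apply, adj2_toBidual, hg]

theorem adj3_image_annihilator_of_distBound {T : X →L[𝕜] Y} {δ : ℝ} (hδ : 0 < δ)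
    (h : DistBound T δ) :
    adj3 T '' (annihilator 𝕜 (canonicalImage 𝕜 Y)) = annihilator 𝕜 (canonicalImage 𝕜 X) := by
  refine Set.Subset.antisymm (Set.image_subset_iff.2 fun g hg => adj3_mem_annihilator T hg) ?_
  intro f hf
  let S : Dual 𝕜 (Dual 𝕜 X) →ₗ[𝕜] Dual 𝕜 (Dual 𝕜 Y) ⧸ canonicalImage 𝕜 Y :=
    ((canonicalImage 𝕜 Y).mkQ).comp (adj2 T : Dual 𝕜 (Dual 𝕜 X) →ₗ[𝕜] Dual 𝕜 (Dual 𝕜 Y))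
  have hbound : ∀ x, ‖f x‖ ≤ ‖f‖ / δ * ‖S x‖ := fun x => by
    have h1 := norm_apply_le_infDist hf x
    have h2 : ‖S x‖ = Metric.infDist (adj2 T x) (canonicalImage 𝕜 Y) := norm_mk_eq_infDist _ _
    rw [h2]
    calc ‖f x‖ ≤ ‖f‖ * Metric.infDist x (canonicalImage 𝕜 X) := h1
      _ = ‖f‖ / δ * (δ * Metric.infDist x (canonicalImage 𝕜 X)) := by field_simp
      _ ≤ _ := by gcongr; exact h x
  have hker : S.ker ≤ ((Dual.toStrongDual 𝕜 _ f : StrongDual 𝕜 _) :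
      Dual 𝕜 (Dual 𝕜 X) →ₗ[𝕜] 𝕜).ker := fun x hx => by
    rw [LinearMap.mem_ker] at hx ⊢
    have := hbound x
    rw [hx, norm_zero, mul_zero] at this
    exact norm_le_zero_iff.1 this
  obtain ⟨φ, hφ⟩ : ∃ φ : S.range →ₗ[𝕜] 𝕜, ∀ x, φ (S.rangeRestrict x) = f x := by
    refine ⟨(S.ker.liftQ _ hker).comp (S.quotKerEquivRange.symm : S.range →ₗ[𝕜] _), fun x => ?_⟩
    have : S.quotKerEquivRange.symm (S.rangeRestrict x) = S.ker.mkQ x :=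
      S.quotKerEquivRange_symm_apply_image x _
    simp only [LinearMap.comp_apply, LinearEquiv.coe_coe, this]
    rfl
  have hφb : ∀ z, ‖φ z‖ ≤ ‖f‖ / δ * ‖z‖ := by
    rintro ⟨_, x, rfl⟩
    have := hφ x
    exact (congrArg norm this).le.trans (hbound x)
  obtain ⟨g, hg, -⟩ := exists_extension_norm_eq S.range (φ.mkContinuous _ hφb)
  refine ⟨(g ∘L (canonicalImage 𝕜 Y).mkQL : StrongDual 𝕜 _), fun y hy => ?_, ?_⟩
  · change g (Submodule.Quotient.mk y) = 0
    rw [(Submodule.Quotient.mk_eq_zero _).2 hy, map_zero]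
  · refine DFunLike.ext _ _ fun x => ?_
    exact (hg (S.rangeRestrict x)).trans (hφ x)

theorem exists_annihilator_preimage_norm_le [CompleteSpace X] [CompleteSpace Y] {T : X →L[𝕜] Y}
    (h : adj3 T '' (annihilator 𝕜 (canonicalImage 𝕜 Y)) = annihilator 𝕜 (canonicalImage 𝕜 X)) :
    ∃ C : ℝ, 0 < C ∧ ∀ f ∈ annihilator 𝕜 (canonicalImage 𝕜 X),
      ∃ g ∈ annihilator 𝕜 (canonicalImage 𝕜 Y), adj3 T g = f ∧ ‖g‖ ≤ C * ‖f‖ := by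
  have hcX := (isClosed_annihilator (canonicalImage 𝕜 X)).completeSpace_coe
  have hcY := (isClosed_annihilator (canonicalImage 𝕜 Y)).completeSpace_coe
  let S : annihilator 𝕜 (canonicalImage 𝕜 Y) →L[𝕜] annihilator 𝕜 (canonicalImage 𝕜 X) :=
    ((adj3 T) ∘L (annihilator 𝕜 (canonicalImage 𝕜 Y)).subtypeL).codRestrict _
      fun g => adj3_mem_annihilator T g.2
  have hsurj : Function.Surjective S := by
    rintro ⟨f, hf⟩
    have hf' : f ∈ adj3 T '' (annihilator 𝕜 (canonicalImage 𝕜 Y)) := by rw [h]; exact hf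
    obtain ⟨g, hg, rfl⟩ := hf'
    exact ⟨⟨g, hg⟩, rfl⟩
  obtain ⟨C, hC, hS⟩ := S.exists_preimage_norm_le hsurj
  refine ⟨C, hC, fun f hf => ?_⟩
  obtain ⟨g, hg, hn⟩ := hS ⟨f, hf⟩
  exact ⟨g, g.2, congrArg Subtype.val hg, hn⟩

end Characterizations

section TripleDual

variable {𝕜 : Type*} [RCLike 𝕜]
variable {X : Type*} [NormedAddCommGroup X] [NormedSpace 𝕜 X]
variable {Y : Type*} [NormedAddCommGroup Y] [NormedSpace 𝕜 Y]

theorem norm_adj_toBidual_le (f : Dual 𝕜 (Dual 𝕜 (Dual 𝕜 X))) :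
    ‖adj (toBidual 𝕜 X) f‖ ≤ ‖f‖ :=
  Dual.norm_le_of_bound _ (norm_nonneg _) fun x => by
    simpa [adj_apply, norm_toBidual] using f.le_norm (toBidual 𝕜 X x)

/-- The projection of `E***` onto `E^⊥` along `E*`. -/
def annihilatorPart (f : Dual 𝕜 (Dual 𝕜 (Dual 𝕜 X))) : Dual 𝕜 (Dual 𝕜 (Dual 𝕜 X)) :=
  f - toBidual 𝕜 (Dual 𝕜 X) (adj (toBidual 𝕜 X) f)

theorem Dual.sub_apply {E : Type*} [NormedAddCommGroup E] [NormedSpace 𝕜 E] (f g : Dual 𝕜 E)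
    (x : E) : (f - g) x = f x - g x := rfl

theorem annihilatorPart_apply (f : Dual 𝕜 (Dual 𝕜 (Dual 𝕜 X))) (x : Dual 𝕜 (Dual 𝕜 X)) :
    annihilatorPart f x = f x - x (adj (toBidual 𝕜 X) f) := rfl

theorem annihilatorPart_mem (f : Dual 𝕜 (Dual 𝕜 (Dual 𝕜 X))) :
    annihilatorPart f ∈ annihilator 𝕜 (canonicalImage 𝕜 X) :=
  mem_annihilator_canonicalImage.2 fun x => by
    rw [annihilatorPart_apply, toBidual_apply, adj_apply, sub_self]

theorem annihilatorPart_of_mem {f : Dual 𝕜 (Dual 𝕜 (Dual 𝕜 X))}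
    (hf : f ∈ annihilator 𝕜 (canonicalImage 𝕜 X)) : annihilatorPart f = f := by
  rw [mem_annihilator_canonicalImage] at hf
  refine DFunLike.ext _ _ fun x => ?_
  have : adj (toBidual 𝕜 X) f = 0 := DFunLike.ext _ _ hf
  rw [annihilatorPart_apply, this, map_zero, sub_zero]

theorem norm_annihilatorPart_le (f : Dual 𝕜 (Dual 𝕜 (Dual 𝕜 X))) :
    ‖annihilatorPart f‖ ≤ 2 * ‖f‖ := by
  refine (norm_sub_le _ _).trans ?_
  rw [norm_toBidual, two_mul]
  exact add_le_add_right (norm_adj_toBidual_le f) _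

theorem annihilatorPart_sub_toBidual (f : Dual 𝕜 (Dual 𝕜 (Dual 𝕜 X))) (x : Dual 𝕜 X) :
    annihilatorPart (f - toBidual 𝕜 (Dual 𝕜 X) x) = annihilatorPart f := by
  refine DFunLike.ext _ _ fun z => ?_
  have h : adj (toBidual 𝕜 X) (toBidual 𝕜 (Dual 𝕜 X) x) = x := rfl
  rw [annihilatorPart_apply, annihilatorPart_apply, map_sub, h, map_sub, Dual.sub_apply,
    toBidual_apply]
  ring

theorem norm_annihilatorPart_le_infDist (f : Dual 𝕜 (Dual 𝕜 (Dual 𝕜 X))) :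
    ‖annihilatorPart f‖ ≤ 2 * Metric.infDist f (canonicalImage 𝕜 (Dual 𝕜 X)) := by
  rw [← div_le_iff₀' two_pos]
  refine (Metric.le_infDist ⟨0, Submodule.zero_mem _⟩).2 ?_
  rintro _ ⟨x, rfl⟩
  rw [div_le_iff₀' two_pos, dist_eq_norm, ← annihilatorPart_sub_toBidual f x]
  exact norm_annihilatorPart_le _

theorem infDist_le_norm_annihilatorPart (f : Dual 𝕜 (Dual 𝕜 (Dual 𝕜 X))) :
    Metric.infDist f (canonicalImage 𝕜 (Dual 𝕜 X)) ≤ ‖annihilatorPart f‖ := by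
  have h : toBidual 𝕜 (Dual 𝕜 X) (adj (toBidual 𝕜 X) f) ∈ canonicalImage 𝕜 (Dual 𝕜 X) :=
    ⟨_, rfl⟩
  exact (Metric.infDist_le_dist_of_mem h).trans_eq (dist_eq_norm _ _)

theorem adj_annihilatorPart (T : X →L[𝕜] Y) (f : Dual 𝕜 (Dual 𝕜 (Dual 𝕜 Y))) :
    adj3 T (annihilatorPart f) = annihilatorPart (adj3 T f) := rfl

theorem norm_le_of_annihilator_bound {G : Dual 𝕜 (Dual 𝕜 (Dual 𝕜 (Dual 𝕜 X)))}
    (hG : G ∈ annihilator 𝕜 (canonicalImage 𝕜 (Dual 𝕜 X))) {C : ℝ} (hC : 0 ≤ C)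
    (h : ∀ f ∈ annihilator 𝕜 (canonicalImage 𝕜 X), ‖G f‖ ≤ C * ‖f‖) : ‖G‖ ≤ 2 * C := by
  refine Dual.norm_le_of_bound _ (by positivity) fun f => ?_
  have h1 : G (annihilatorPart f) = G f := by
    rw [annihilatorPart, map_sub, mem_annihilator_canonicalImage.1 hG, sub_zero]
  rw [← h1]
  refine (h _ (annihilatorPart_mem f)).trans ?_
  rw [mul_comm 2 C, mul_assoc]
  exact mul_le_mul_of_nonneg_left (norm_annihilatorPart_le f) hC

theorem isIntoIsomorphism_adj4_of_adj3_image [CompleteSpace X] [CompleteSpace Y]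
    {T : X →L[𝕜] Y}
    (h : adj3 T '' (annihilator 𝕜 (canonicalImage 𝕜 Y)) = annihilator 𝕜 (canonicalImage 𝕜 X)) :
    IsIntoIsomorphism
      (adj4 T ∘L (annihilator 𝕜 (canonicalImage 𝕜 (Dual 𝕜 X))).subtypeL) := by
  obtain ⟨C, hC, hT⟩ := exists_annihilator_preimage_norm_le h
  refine (isIntoIsomorphism_iff _).2 ⟨(2 * C)⁻¹, by positivity, ?_⟩
  rintro ⟨G, hG⟩
  change _ * ‖G‖ ≤ ‖adj4 T G‖
  rw [inv_mul_le_iff₀ (by positivity), mul_assoc]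
  refine norm_le_of_annihilator_bound hG (by positivity) fun f hf => ?_
  obtain ⟨g, -, rfl, hn⟩ := hT f hf
  have := (adj4 T G).le_norm g
  rw [adj_apply] at this
  refine this.trans ?_
  rw [mul_comm C, mul_assoc]
  exact mul_le_mul_of_nonneg_left hn (norm_nonneg _)

/-- The canonical map `X** → (X*)^⊥ ⊆ X****`, which factors through `X**/X`. -/
def bidualToAnnihilator (x : Dual 𝕜 (Dual 𝕜 X)) : Dual 𝕜 (Dual 𝕜 (Dual 𝕜 (Dual 𝕜 X))) :=
  toBidual 𝕜 (Dual 𝕜 (Dual 𝕜 X)) x - adj2 (toBidual 𝕜 X) x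

theorem bidualToAnnihilator_apply (x : Dual 𝕜 (Dual 𝕜 X)) (f : Dual 𝕜 (Dual 𝕜 (Dual 𝕜 X))) :
    bidualToAnnihilator x f = annihilatorPart f x := rfl

theorem bidualToAnnihilator_mem (x : Dual 𝕜 (Dual 𝕜 X)) :
    bidualToAnnihilator x ∈ annihilator 𝕜 (canonicalImage 𝕜 (Dual 𝕜 X)) :=
  mem_annihilator_canonicalImage.2 fun f => by
    rw [bidualToAnnihilator_apply, annihilatorPart_apply]
    exact sub_self (x f)

theorem adj4_bidualToAnnihilator (T : X →L[𝕜] Y) (x : Dual 𝕜 (Dual 𝕜 X)) :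
    adj4 T (bidualToAnnihilator x) = bidualToAnnihilator (adj2 T x) := rfl

theorem infDist_le_norm_bidualToAnnihilator (x : Dual 𝕜 (Dual 𝕜 X)) :
    Metric.infDist x (canonicalImage 𝕜 X) ≤ ‖bidualToAnnihilator x‖ := by
  obtain ⟨f, hf, hn, hx⟩ := exists_annihilator_apply_eq (canonicalImage 𝕜 X) x
  have h := (bidualToAnnihilator x).le_norm f
  rw [bidualToAnnihilator_apply, annihilatorPart_of_mem hf, hx, RCLike.norm_ofReal,
    abs_of_nonneg Metric.infDist_nonneg] at h
  exact h.trans (mul_le_of_le_one_right (norm_nonneg _) hn)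

theorem norm_bidualToAnnihilator_le (x : Dual 𝕜 (Dual 𝕜 X)) :
    ‖bidualToAnnihilator x‖ ≤ 2 * Metric.infDist x (canonicalImage 𝕜 X) := by
  have h0 : 0 ≤ Metric.infDist x (canonicalImage 𝕜 X) := Metric.infDist_nonneg
  refine Dual.norm_le_of_bound _ (by positivity) fun f => ?_
  rw [bidualToAnnihilator_apply]
  refine (norm_apply_le_infDist (annihilatorPart_mem f) x).trans ?_
  nlinarith [norm_annihilatorPart_le f]

theorem exists_distBound_of_isIntoIsomorphism_adj4 {T : X →L[𝕜] Y}
    (h : IsIntoIsomorphism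
      (adj4 T ∘L (annihilator 𝕜 (canonicalImage 𝕜 (Dual 𝕜 X))).subtypeL)) :
    ∃ δ : ℝ, 0 < δ ∧ DistBound T δ := by
  obtain ⟨δ, hδ, hb⟩ := (isIntoIsomorphism_iff _).1 h
  refine ⟨δ / 2, by positivity, fun x => ?_⟩
  have h1 : δ * ‖bidualToAnnihilator x‖ ≤ ‖adj4 T (bidualToAnnihilator x)‖ :=
    hb ⟨_, bidualToAnnihilator_mem x⟩
  rw [adj4_bidualToAnnihilator] at h1
  nlinarith [norm_bidualToAnnihilator_le (adj2 T x), infDist_le_norm_bidualToAnnihilator x]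

theorem isStronglyTauberian_adj2_iff (T : X →L[𝕜] Y) :
    IsStronglyTauberian (adj2 T) ↔ IsIntoIsomorphism
      (adj4 T ∘L (annihilator 𝕜 (canonicalImage 𝕜 (Dual 𝕜 X))).subtypeL) := by
  rw [isStronglyTauberian_iff, isIntoIsomorphism_iff]
  constructor
  · rintro ⟨δ, hδ, h⟩
    refine ⟨δ / 2, by positivity, ?_⟩
    rintro ⟨G, hG⟩
    change _ * ‖G‖ ≤ ‖adj4 T G‖
    have h1 := h G
    have h2 := norm_annihilatorPart_le_infDist G
    rw [annihilatorPart_of_mem hG] at h2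
    have h3 := infDist_le_norm_annihilatorPart (adj4 T G)
    have h4 : annihilatorPart (adj4 T G) = adj4 T G := by
      rw [← adj_annihilatorPart, annihilatorPart_of_mem hG]
    rw [h4] at h3
    have := h1.trans h3
    nlinarith
  · rintro ⟨δ, hδ, h⟩
    refine ⟨δ / 2, by positivity, fun G => ?_⟩
    have h1 : δ * ‖annihilatorPart G‖ ≤ ‖adj4 T (annihilatorPart G)‖ :=
      h ⟨_, annihilatorPart_mem G⟩
    have h2 := infDist_le_norm_annihilatorPart G
    have h3 := norm_annihilatorPart_le_infDist (adj4 T G)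
    rw [← adj_annihilatorPart] at h3
    change _ ≤ Metric.infDist (adj4 T G) _
    nlinarith

end TripleDual

section WeakStarApproximation

variable {𝕜 : Type*} [RCLike 𝕜] {E : Type*} [NormedAddCommGroup E] [NormedSpace 𝕜 E]

theorem Dual.norm_mul_le_of_re_le (f : Dual 𝕜 E) {r b : ℝ} (hr : 0 ≤ r)
    (h : ∀ x, ‖x‖ ≤ r → RCLike.re (f x) ≤ b) : ‖f‖ * r ≤ b := by
  rcases hr.eq_or_lt with rfl | hr
  · simpa using h 0 (by simp)
  rw [← le_div_iff₀ hr]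
  refine ContinuousLinearMap.opNorm_bound_of_ball_bound hr b (Dual.toStrongDual 𝕜 E f)
    fun x hx => ?_
  rw [mem_closedBall_zero_iff] at hx
  change ‖f x‖ ≤ b
  obtain ⟨a, ha, hax⟩ := RCLike.exists_norm_mul_eq_self (f x)
  have h1 := h ((starRingEnd 𝕜 a) • x) (by rwa [norm_smul, RCLike.norm_conj, ha, one_mul])
  rw [map_smul, smul_eq_mul] at h1
  have h2 : starRingEnd 𝕜 a * f x = (‖f x‖ : 𝕜) := by
    conv_lhs => rw [← hax]
    rw [mul_left_comm, ← mul_assoc, RCLike.mul_conj, ha]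
    simp
  rwa [h2, RCLike.ofReal_re] at h1

/-- A point in the weak-star closure of the image of a convex set in the bidual is no closer to the
canonical image of `e` than the convex set is to `e`. -/
theorem exists_mem_norm_sub_lt {C : Set E}
    (hC : ∀ x ∈ C, ∀ y ∈ C, ∀ a b : ℝ, 0 ≤ a → 0 ≤ b → a + b = 1 →
      (a : 𝕜) • x + (b : 𝕜) • y ∈ C)
    (z : Dual 𝕜 (Dual 𝕜 E))
    (hz : ∀ (h : Dual 𝕜 E) (b : ℝ), (∀ w ∈ C, RCLike.re (h w) ≤ b) → RCLike.re (z h) ≤ b)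
    (e : E) {r : ℝ} (hr : ‖z - toBidual 𝕜 E e‖ < r) : ∃ w ∈ C, ‖w - e‖ < r := by
  let : NormedSpace ℝ E := NormedSpace.restrictScalars ℝ 𝕜 E
  have : IsScalarTower ℝ 𝕜 E := RestrictScalars.isScalarTower ℝ 𝕜 E
  have hcoe : ∀ (a : ℝ) (x : E), a • x = (a : 𝕜) • x := fun a x =>
    RCLike.real_smul_eq_coe_smul a x
  have hconv : Convex ℝ C := fun x hx y hy a b ha hb hab => by
    rw [hcoe, hcoe]; exact hC x hx y hy a b ha hb hab
  by_contra! hne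
  have hdisj : Disjoint (Metric.ball e r) C := Set.disjoint_left.2 fun w hw hwC => by
    rw [mem_ball_iff_norm] at hw
    exact absurd hw (hne w hwC).not_gt
  obtain ⟨f, u, hf1, hf2⟩ := RCLike.geometric_hahn_banach_open (𝕜 := 𝕜) (convex_ball e r)
    Metric.isOpen_ball hconv hdisj
  let h : Dual 𝕜 E := (Dual.toStrongDual 𝕜 E).symm f
  have hz1 : u ≤ RCLike.re (z h) := by
    have := hz (-h) (-u) fun w hw => by
      have : (-h) w = - f w := rfl
      rw [this, map_neg]
      exact neg_le_neg (hf2 w hw)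
    rw [map_neg, map_neg] at this
    exact neg_le_neg_iff.1 this
  have hpos : 0 < r := (norm_nonneg _).trans_lt hr
  have he : RCLike.re (h e) < u := hf1 e (Metric.mem_ball_self hpos)
  have hsub : RCLike.re (z h) - RCLike.re (h e) ≤ ‖z - toBidual 𝕜 E e‖ * ‖h‖ := by
    have h1 := (z - toBidual 𝕜 E e).le_norm h
    rw [Dual.sub_apply, toBidual_apply] at h1
    rw [← map_sub]
    exact (RCLike.re_le_norm _).trans h1
  have hball : ∀ ρ, 0 ≤ ρ → ρ < r → ‖h‖ * ρ ≤ u - RCLike.re (h e) := fun ρ hρ hρr => by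
    refine h.norm_mul_le_of_re_le hρ fun x hx => ?_
    have h1 : RCLike.re (h (e + x)) < u := hf1 (e + x) (by
      rw [mem_ball_iff_norm, add_sub_cancel_left]; exact hx.trans_lt hρr)
    rw [map_add, map_add] at h1
    linarith
  have h1 := hball ((‖z - toBidual 𝕜 E e‖ + r) / 2) (by positivity) (by linarith)
  have h2 := norm_nonneg h
  rcases h2.eq_or_lt with h0 | h0
  · rw [← h0, mul_zero] at hsub
    linarith
  · nlinarith

theorem exists_norm_le_approx {X Y : Type*} [NormedAddCommGroup X] [NormedSpace 𝕜 X]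
    [NormedAddCommGroup Y] [NormedSpace 𝕜 Y] (T : X →L[𝕜] Y) {x : Dual 𝕜 (Dual 𝕜 X)} {R : ℝ}
    (hx : ‖x‖ ≤ R) {y : Y} {r : ℝ} (hr : ‖adj2 T x - toBidual 𝕜 Y y‖ < r)
    (s : Finset (Dual 𝕜 X)) {ε : Dual 𝕜 X → ℝ} (hε : ∀ g, 0 < ε g) :
    ∃ w : X, ‖w‖ ≤ R ∧ ‖T w - y‖ < r ∧ ∀ g ∈ s, ‖g w - x g‖ < ε g := by
  classical
  have hpos : 0 < r := (norm_nonneg _).trans_lt hr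
  let k : s → 𝕜 := fun g => ((r / ε g : ℝ) : 𝕜)
  let A : X →L[𝕜] Y × (s → 𝕜) :=
    T.prod (ContinuousLinearMap.pi fun g => k g • Dual.toStrongDual 𝕜 X g)
  have hA : ∀ w, A w = (T w, fun g => k g * (g : Dual 𝕜 X) w) := fun w => rfl
  let e : Y × (s → 𝕜) := (y, fun g => k g * x g)
  have hnorm : ‖adj2 A x - toBidual 𝕜 _ e‖ < r := by
    refine lt_of_le_of_lt (Dual.norm_le_of_bound _ (norm_nonneg _) fun h => ?_) hr
    let h1 : Dual 𝕜 Y := (Dual.toStrongDual 𝕜 Y).symm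
      ((Dual.toStrongDual 𝕜 _ h) ∘L ContinuousLinearMap.inl 𝕜 Y (s → 𝕜))
    have hh1 : ∀ v, h1 v = h (v, 0) := fun v => rfl
    have hh : ∀ (v : Y) (a : s → 𝕜), h (v, a) = h1 v + ∑ g, a g * h (0, Pi.single g 1) := by
      intro v a
      have : (v, a) = (v, (0 : s → 𝕜)) + ∑ g, a g • ((0 : Y), (Pi.single g 1 : s → 𝕜)) := by
        refine Prod.ext ?_ ?_
        · simp [Prod.fst_sum]
        · simpa [Prod.snd_sum] using pi_eq_sum_univ' a
      rw [this, map_add, map_sum, hh1]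
      simp only [map_smul, smul_eq_mul]
    have hadj : adj A h = adj T h1 + ∑ g : s, (h (0, Pi.single g 1) * k g) • (g : Dual 𝕜 X) := by
      refine DFunLike.ext _ _ fun w => ?_
      have : ∀ t : Finset s, (∑ g ∈ t, (h (0, Pi.single g 1) * k g) • (g : Dual 𝕜 X)) w =
          ∑ g ∈ t, (h (0, Pi.single g 1) * k g) * (g : Dual 𝕜 X) w := fun t => by
        rw [← toBidual_apply 𝕜, map_sum]
        simp only [map_smul, toBidual_apply, smul_eq_mul]
      rw [Dual.add_apply, this, adj_apply, adj_apply, hA, hh]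
      congr 1
      exact Finset.sum_congr rfl fun g _ => by ring
    have hle : ‖h1‖ ≤ ‖h‖ := Dual.norm_le_of_bound _ (norm_nonneg _) fun v => by
      rw [hh1]
      simpa using h.le_norm (v, 0)
    have : (adj2 A x - toBidual 𝕜 _ e) h = (adj2 T x - toBidual 𝕜 Y y) h1 := by
      rw [Dual.sub_apply, Dual.sub_apply, adj_apply, adj_apply, toBidual_apply, toBidual_apply,
        hadj, hh, map_add, map_sum]
      simp only [map_smul, smul_eq_mul]
      have : ∑ g : s, h (0, Pi.single g 1) * k g * x g =
          ∑ g : s, k g * x g * h (0, Pi.single g 1) :=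
        Finset.sum_congr rfl fun g _ => by ring
      rw [this, add_sub_add_right_eq_sub]
    rw [this]
    exact ((adj2 T x - toBidual 𝕜 Y y).le_norm h1).trans
      (mul_le_mul_of_nonneg_left hle (norm_nonneg _))
  have hconv : ∀ v ∈ A '' Metric.closedBall 0 R, ∀ v' ∈ A '' Metric.closedBall 0 R,
      ∀ a b : ℝ, 0 ≤ a → 0 ≤ b → a + b = 1 →
        (a : 𝕜) • v + (b : 𝕜) • v' ∈ A '' Metric.closedBall 0 R := by
    rintro _ ⟨w1, h1, rfl⟩ _ ⟨w2, h2, rfl⟩ a b ha hb hab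
    rw [mem_closedBall_zero_iff] at h1 h2
    refine ⟨(a : 𝕜) • w1 + (b : 𝕜) • w2, ?_, by simp only [map_add, map_smul]⟩
    rw [mem_closedBall_zero_iff]
    calc ‖(a : 𝕜) • w1 + (b : 𝕜) • w2‖ ≤ ‖(a : 𝕜) • w1‖ + ‖(b : 𝕜) • w2‖ := norm_add_le _ _
      _ = a * ‖w1‖ + b * ‖w2‖ := by
        rw [norm_smul, norm_smul, RCLike.norm_ofReal, RCLike.norm_ofReal, abs_of_nonneg ha,
          abs_of_nonneg hb]
      _ ≤ a * R + b * R := by gcongr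
      _ = R := by rw [← add_mul, hab, one_mul]
  have hsup : ∀ (h : Dual 𝕜 (Y × (s → 𝕜))) (b : ℝ),
      (∀ v ∈ A '' Metric.closedBall 0 R, RCLike.re (h v) ≤ b) → RCLike.re (adj2 A x h) ≤ b := by
    intro h b hb
    have hR : 0 ≤ R := (norm_nonneg x).trans hx
    have h1 : ‖adj A h‖ * R ≤ b := (adj A h).norm_mul_le_of_re_le hR fun w hw =>
      hb _ ⟨w, mem_closedBall_zero_iff.2 hw, rfl⟩
    refine le_trans ?_ h1
    refine (RCLike.re_le_norm _).trans ((x.le_norm (adj A h)).trans ?_)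
    rw [mul_comm]
    exact mul_le_mul_of_nonneg_left hx (norm_nonneg _)
  obtain ⟨_, ⟨w, hw, rfl⟩, hwr⟩ := exists_mem_norm_sub_lt hconv (adj2 A x) hsup e hnorm
  rw [mem_closedBall_zero_iff] at hw
  refine ⟨w, hw, ?_, fun g hg => ?_⟩
  · exact (norm_fst_le (A w - e)).trans_lt hwr
  · have h1 := ((norm_le_pi_norm (A w - e).2 ⟨g, hg⟩).trans (norm_snd_le (A w - e))).trans_lt hwr
    have h2 : (A w - e).2 ⟨g, hg⟩ = k ⟨g, hg⟩ * (g w - x g) := by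
      change k ⟨g, hg⟩ * g w - k ⟨g, hg⟩ * x g = _
      ring
    rw [h2, norm_mul, RCLike.norm_ofReal, abs_of_pos (div_pos hpos (hε g)),
      div_mul_eq_mul_div, div_lt_iff₀ (hε g)] at h1
    exact lt_of_mul_lt_mul_left h1 hpos.le

/-- Banach–Alaoglu: a bounded family in a dual converges weak-star along every ultrafilter. -/
theorem exists_tendsto_dual_apply {ι : Type*} (U : Ultrafilter ι) (φ : ι → Dual 𝕜 E) {R : ℝ}
    (hφ : ∀ i, ‖φ i‖ ≤ R) :
    ∃ ψ : Dual 𝕜 E, ‖ψ‖ ≤ R ∧ ∀ e, Tendsto (fun i => φ i e) U (𝓝 (ψ e)) := by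
  let Φ : ι → WeakDual 𝕜 E := fun i => StrongDual.toWeakDual (Dual.toStrongDual 𝕜 E (φ i))
  have hc := WeakDual.isCompact_closedBall (𝕜 := 𝕜) (0 : StrongDual 𝕜 E) R
  obtain ⟨ψ, hψ, hlim⟩ := hc.ultrafilter_le_nhds (U.map Φ) (by
    rw [le_principal_iff, Ultrafilter.mem_coe, Ultrafilter.mem_map]
    refine Filter.univ_mem' fun i => ?_
    exact mem_closedBall_zero_iff.2 (hφ i))
  refine ⟨(Dual.toStrongDual 𝕜 E).symm (WeakDual.toStrongDual ψ),
    mem_closedBall_zero_iff.1 hψ, fun e => ?_⟩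
  have hev : Continuous fun f : WeakDual 𝕜 E => f e := WeakDual.eval_continuous e
  exact (hev.tendsto ψ).comp (show Tendsto Φ U (𝓝 ψ) from hlim)

end WeakStarApproximation

section BasicSequences

variable {𝕜 : Type*} [RCLike 𝕜] {X : Type*} [NormedAddCommGroup X] [NormedSpace 𝕜 X]

theorem exists_sum_range_of_mem_span {b : ℕ → X} {x : X}
    (hx : x ∈ Submodule.span 𝕜 (Set.range b)) :
    ∃ (c : ℕ → 𝕜) (N : ℕ), ∀ n, N ≤ n → ∑ j ∈ Finset.range n, c j • b j = x := by
  obtain ⟨c, rfl⟩ := Finsupp.mem_span_range_iff_exists_finsupp.1 hx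
  obtain ⟨N, hN⟩ := c.support.exists_nat_subset_range
  refine ⟨c, N, fun n hn => ?_⟩
  exact (Finsupp.sum_of_support_subset c (hN.trans (Finset.range_mono hn)) (fun i a => a • b i)
    (by simp)).symm

/-- Biorthogonal functionals of a sequence whose coefficients are controlled by the norm. -/
theorem exists_biorthogonal {b : ℕ → X} {C : ℝ}
    (hC : ∀ (c : ℕ → 𝕜) (N j : ℕ), j < N → ‖c j‖ ≤ C * ‖∑ i ∈ Finset.range N, c i • b i‖) (j : ℕ) :
    ∃ f : StrongDual 𝕜 X, ∀ i, f (b i) = (Pi.single i (1 : 𝕜) : ℕ → 𝕜) j := by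
  have hli : LinearIndependent 𝕜 b := by
    rw [linearIndependent_iff']
    intro s g hg i hi
    obtain ⟨N, hN⟩ := s.exists_nat_subset_range
    have h1 := hC (fun k => if k ∈ s then g k else 0) N i (Finset.mem_range.1 (hN hi))
    have h2 : ∑ k ∈ Finset.range N, (if k ∈ s then g k else 0) • b k = 0 := by
      rw [← hg]
      simp only [ite_smul, zero_smul]
      rw [← Finset.sum_filter, Finset.filter_mem_eq_inter, Finset.inter_eq_right.2 hN]
    rw [h2, norm_zero, mul_zero, if_pos hi] at h1
    exact norm_le_zero_iff.1 h1
  let B := Module.Basis.span hli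
  have hB : ∀ i, (B i : X) = b i := fun i =>
    congrArg Subtype.val (Module.Basis.span_apply hli i)
  have hbound : ∀ x, ‖B.coord j x‖ ≤ C * ‖x‖ := fun x => by
    obtain ⟨N, hN⟩ := (B.repr x).support.exists_nat_subset_range
    have h1 := hC (fun k => B.repr x k) (max N (j + 1)) j (by simp)
    have h2 : ∑ k ∈ Finset.range (max N (j + 1)), B.repr x k • b k = x := by
      conv_rhs => rw [← B.linearCombination_repr x]
      rw [Finsupp.linearCombination_apply, Finsupp.sum_of_support_subset _
        (hN.trans (Finset.range_mono (le_max_left N (j + 1)))) _ (by simp)]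
      simp [hB]
    rw [h2] at h1
    exact h1
  obtain ⟨f, hf, -⟩ := exists_extension_norm_eq _ ((B.coord j).mkContinuous C hbound)
  refine ⟨f, fun i => ?_⟩
  rw [← hB i, hf, LinearMap.mkContinuous_apply, Module.Basis.coord_apply, B.repr_self]
  rw [Finsupp.single_apply, Pi.single_apply]
  simp only [eq_comm]

/-- Grunblum's criterion. -/
theorem isKBasic_of_norm_sum_le {b : ℕ → X} {K C : ℝ}
    (hK : ∀ (c : ℕ → 𝕜) (N m : ℕ), m ≤ N → ‖∑ i ∈ Finset.range m, c i • b i‖ ≤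
      K * ‖∑ i ∈ Finset.range N, c i • b i‖)
    (hC : ∀ (c : ℕ → 𝕜) (N j : ℕ), j < N → ‖c j‖ ≤ C * ‖∑ i ∈ Finset.range N, c i • b i‖) :
    IsKBasic 𝕜 K b := by
  refine ⟨?_, fun c x hx k => ?_⟩
  · choose f hf using exists_biorthogonal (𝕜 := 𝕜) hC
    let P : ℕ → X →L[𝕜] X := fun n => ∑ i ∈ Finset.range n, (f i).smulRight (b i)
    have hP : ∀ n x, P n x = ∑ i ∈ Finset.range n, f i x • b i := fun n x => by
      simp [P]
    have hPb : ∀ n i, i < n → P n (b i) = b i := fun n i hi => by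
      rw [hP, Finset.sum_eq_single i]
      · rw [hf, Pi.single_eq_same, one_smul]
      · intro k _ hk
        rw [hf, Pi.single_eq_of_ne hk, zero_smul]
      · simp [hi]
    have hPb' : ∀ n i, n ≤ i → P n (b i) = 0 := fun n i hi => by
      rw [hP]
      refine Finset.sum_eq_zero fun k hk => ?_
      rw [hf, Pi.single_eq_of_ne (by have := Finset.mem_range.1 hk; omega), zero_smul]
    let V := Submodule.span 𝕜 (Set.range b)
    have hPspan : ∀ x ∈ V, (∀ n, ‖P n x‖ ≤ K * ‖x‖) ∧ ∀ᶠ n in atTop, P n x = x := by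
      intro x hx
      obtain ⟨c, N, hc⟩ := exists_sum_range_of_mem_span hx
      refine ⟨fun n => ?_, ?_⟩
      · have h1 := hK c (max N n) n (le_max_right _ _)
        rw [hc _ (le_max_left _ _)] at h1
        convert h1
        rw [← hc _ (le_max_left N n), map_sum,
          ← Finset.sum_subset (Finset.range_mono (le_max_right N n))]
        · refine Finset.sum_congr rfl fun i hi => ?_
          rw [map_smul, hPb n i (Finset.mem_range.1 hi)]
        · intro i _ hi
          rw [map_smul, hPb' n i (by simpa using hi), smul_zero]
      · filter_upwards [eventually_ge_atTop N] with n hn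
        rw [← hc _ hn, map_sum]
        refine Finset.sum_congr rfl fun i hi => ?_
        rw [map_smul, hPb n i (Finset.mem_range.1 hi)]
    have hPclo : ∀ x ∈ V.topologicalClosure, ∀ n, ‖P n x‖ ≤ K * ‖x‖ := by
      intro x hx n
      have hcl : IsClosed {x : X | ‖P n x‖ ≤ K * ‖x‖} :=
        isClosed_le (by fun_prop) (by fun_prop)
      exact closure_minimal (fun y hy => (hPspan y hy).1 n) hcl hx
    have hK0 : 0 ≤ K := by
      have h0 : 0 < ‖b 0‖ := by
        rw [norm_pos_iff]
        intro h
        have := hf 0 0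
        rw [h, map_zero, Pi.single_eq_same] at this
        exact zero_ne_one this
      have := hK (fun _ => 1) 1 1 le_rfl
      simp only [Finset.sum_range_one, one_smul] at this
      by_contra! hneg
      nlinarith
    have hlim : ∀ x ∈ V.topologicalClosure, Tendsto (fun n => P n x) atTop (𝓝 x) := by
      intro x hx
      rw [Metric.tendsto_atTop]
      intro ε hε
      obtain ⟨y, hy, hxy⟩ := Metric.mem_closure_iff.1
        (show x ∈ closure (V : Set X) from hx) (ε / (K + 2)) (by positivity)
      obtain ⟨N, hN⟩ := eventually_atTop.1 (hPspan y hy).2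
      refine ⟨N, fun n hn => ?_⟩
      have h1 : P n x - x = P n (x - y) - (x - y) := by
        rw [map_sub, hN n hn]; abel
      have h2 := hPclo (x - y) (sub_mem hx (V.le_topologicalClosure hy)) n
      rw [dist_eq_norm] at hxy ⊢
      rw [lt_div_iff₀ (by positivity)] at hxy
      rw [h1]
      calc _ ≤ ‖P n (x - y)‖ + ‖x - y‖ := norm_sub_le _ _
        _ ≤ K * ‖x - y‖ + ‖x - y‖ := by gcongr
        _ ≤ ‖x - y‖ * (K + 2) := by nlinarith [norm_nonneg (x - y)]
        _ < ε := hxy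
    refine ⟨⟨fun n => ⟨b n, V.le_topologicalClosure (Submodule.subset_span ⟨n, rfl⟩)⟩,
      fun n => f n ∘L V.topologicalClosure.subtypeL, fun i j => by convert! hf i j,
      fun x => ?_⟩, fun n => rfl⟩
    rw [HasSum, SummationFilter.conditional_filter_eq_map_range, tendsto_map'_iff,
      tendsto_subtype_rng]
    refine (hlim x x.2).congr fun n => ?_
    simp [hP]
  · refine le_of_tendsto_of_tendsto tendsto_const_nhds (hx.norm.const_mul K) ?_
    filter_upwards [eventually_ge_atTop k] with n hn using hK c n k hn

theorem isWideS_of_norm_sum_le {b : ℕ → X} {lam : ℝ}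
    (hK : ∀ (c : ℕ → 𝕜) (N m : ℕ), m ≤ N → ‖∑ i ∈ Finset.range m, c i • b i‖ ≤
      2 * lam * ‖∑ i ∈ Finset.range N, c i • b i‖)
    (hb : ∀ j, ‖b j‖ ≤ lam)
    (hs : ∀ (c : ℕ → 𝕜) (N m : ℕ), m ≤ N → ‖∑ i ∈ Finset.Ico m N, c i‖ ≤
      lam * ‖∑ i ∈ Finset.range N, c i • b i‖) : IsWideS 𝕜 lam b := by
  refine ⟨isKBasic_of_norm_sum_le (C := 2 * lam) hK fun c N j hj => ?_, hb, fun k n hkn c => ?_⟩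
  · have h1 := hs c N j hj.le
    have h2 := hs c N (j + 1) hj
    rw [Finset.sum_eq_sum_Ico_succ_bot hj] at h1
    calc ‖c j‖ = ‖(c j + ∑ i ∈ Finset.Ico (j + 1) N, c i) - ∑ i ∈ Finset.Ico (j + 1) N, c i‖ := by
          rw [add_sub_cancel_right]
      _ ≤ _ := norm_sub_le _ _
      _ ≤ _ := add_le_add h1 h2
      _ = _ := by ring
  · exact hs c (n + 1) k (by omega)

/-- A weak-star cluster point of a wide-(s) sequence stays away from the space. -/
theorem IsWideS.le_infDist {b : ℕ → X} {lam : ℝ} (hlam : 0 < lam) (hb : IsWideS 𝕜 lam b)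
    {U : Ultrafilter ℕ} (hU : (U : Filter ℕ) ≤ atTop) {z : Dual 𝕜 (Dual 𝕜 X)}
    (hz : ∀ g : Dual 𝕜 X, Tendsto (fun i => g (b i)) U (𝓝 (z g))) :
    1 / (2 * lam) ≤ Metric.infDist z (canonicalImage 𝕜 X) := by
  by_contra! hlt
  obtain ⟨_, ⟨x, rfl⟩, hx⟩ := (Metric.infDist_lt_iff ⟨0, Submodule.zero_mem _⟩).1 hlt
  rw [dist_eq_norm] at hx
  let σ := Finsupp.linearCombination 𝕜 (fun _ : ℕ => (1 : 𝕜))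
  let β := Finsupp.linearCombination 𝕜 b
  have key : ∀ N, ∃ c : ℕ →₀ 𝕜, (∀ j < N, c j = 0) ∧ σ c = 1 ∧ ‖β c - x‖ < 1 / (2 * lam) := by
    intro N
    have hconv : ∀ v ∈ {w | ∃ c : ℕ →₀ 𝕜, (∀ j < N, c j = 0) ∧ σ c = 1 ∧ β c = w},
        ∀ v' ∈ {w | ∃ c : ℕ →₀ 𝕜, (∀ j < N, c j = 0) ∧ σ c = 1 ∧ β c = w},
        ∀ s t : ℝ, 0 ≤ s → 0 ≤ t → s + t = 1 → (s : 𝕜) • v + (t : 𝕜) • v' ∈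
          {w | ∃ c : ℕ →₀ 𝕜, (∀ j < N, c j = 0) ∧ σ c = 1 ∧ β c = w} := by
      rintro _ ⟨c, hc0, hc1, rfl⟩ _ ⟨c', hc0', hc1', rfl⟩ s t - - hst
      refine ⟨(s : 𝕜) • c + (t : 𝕜) • c', fun j hj => ?_, ?_, by simp only [map_add, map_smul]⟩
      · simp [hc0 j hj, hc0' j hj]
      · rw [map_add, map_smul, map_smul, hc1, hc1', smul_eq_mul, smul_eq_mul, mul_one, mul_one,
          ← RCLike.ofReal_add, hst, RCLike.ofReal_one]
    obtain ⟨_, ⟨c, hc0, hc1, rfl⟩, hc⟩ :=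
      exists_mem_norm_sub_lt hconv z (fun h r hr => by
        have h1 : Tendsto (fun i => RCLike.re (h (b i))) U (𝓝 (RCLike.re (z h))) :=
          (RCLike.continuous_re.tendsto _).comp (hz h)
        refine le_of_tendsto h1 (hU ?_)
        filter_upwards [eventually_ge_atTop N] with i hi
        refine hr _ ⟨Finsupp.single i 1, fun j hj => Finsupp.single_eq_of_ne (by omega), ?_, ?_⟩
        · simp [σ]
        · simp [β]) x hx
    exact ⟨c, hc0, hc1, hc⟩
  obtain ⟨c, -, hc1, hcx⟩ := key 0
  obtain ⟨N, hN⟩ := c.support.exists_nat_subset_range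
  obtain ⟨c', hc0', hc1', hcx'⟩ := key N
  obtain ⟨N', hN'⟩ := c'.support.exists_nat_subset_range
  have hb1 := hb.norm_sum_le N (max N N') (le_max_left _ _) fun i => c' i - c i
  have hsub : ∀ d : ℕ →₀ 𝕜, d.support ⊆ Finset.range (max N N' + 1) →
      ∑ i ∈ Finset.range (max N N' + 1), d i • b i = β d := fun d hd =>
    (Finsupp.sum_of_support_subset d hd (fun i a => a • b i) (by simp)).symm
  have hcsub : c.support ⊆ Finset.range (max N N' + 1) :=
    hN.trans (Finset.range_mono (by omega))
  have hcsub' : c'.support ⊆ Finset.range (max N N' + 1) :=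
    hN'.trans (Finset.range_mono (by omega))
  have h1 : ∑ i ∈ Finset.range (max N N' + 1), (c' i - c i) • b i = β c' - β c := by
    simp only [sub_smul, Finset.sum_sub_distrib]
    rw [hsub c hcsub, hsub c' hcsub']
  have h2 : ∑ i ∈ Finset.Icc N (max N N'), (c' i - c i) = 1 := by
    rw [← hc1']
    have : σ c' = ∑ i ∈ Finset.range (max N N' + 1), c' i := by
      rw [Finsupp.linearCombination_apply, Finsupp.sum_of_support_subset _ hcsub' _ (by simp)]
      simp
    rw [this]
    refine Finset.sum_subset_zero_on_sdiff ?_ ?_ ?_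
    · intro i hi
      rw [Finset.mem_Icc] at hi
      rw [Finset.mem_range]; omega
    · intro i hi
      rw [Finset.mem_sdiff, Finset.mem_range, Finset.mem_Icc] at hi
      exact hc0' i (by omega)
    · intro i hi
      rw [Finset.mem_Icc] at hi
      have : c i = 0 := by
        by_contra h
        have := Finset.mem_range.1 (hN (Finsupp.mem_support_iff.2 h))
        omega
      rw [this, sub_zero]
  rw [h1, h2, norm_one] at hb1
  have h3 : ‖β c' - β c‖ < 1 / lam := by
    calc ‖β c' - β c‖ = ‖(β c' - x) - (β c - x)‖ := by rw [sub_sub_sub_cancel_right]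
      _ ≤ _ := norm_sub_le _ _
      _ < 1 / (2 * lam) + 1 / (2 * lam) := add_lt_add hcx' hcx
      _ = 1 / lam := by field_simp; norm_num
  rw [lt_div_iff₀' hlam] at h3
  exact absurd hb1 h3.not_ge

end BasicSequences

section Selection

variable {𝕜 : Type*} [RCLike 𝕜]

/-- A finite-dimensional space of functionals is almost normed by finitely many points. -/
theorem exists_finset_norming {E : Type*} [NormedAddCommGroup E] [NormedSpace 𝕜 E]
    (V : Submodule 𝕜 (Dual 𝕜 E)) [FiniteDimensional 𝕜 V] {θ : ℝ} (hθ : 1 < θ) :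
    ∃ s : Finset E, ∀ f ∈ V, ∃ e ∈ s, ‖e‖ ≤ 1 ∧ ‖f‖ ≤ θ * ‖f e‖ := by
  classical
  have : ProperSpace V := FiniteDimensional.proper_rclike 𝕜 V
  have hθ0 : 0 < θ := one_pos.trans hθ
  have hpt : ∀ f : V, f ∈ Metric.sphere (0 : V) 1 →
      ∃ e : E, ‖e‖ ≤ 1 ∧ 1 / θ < ‖(f : Dual 𝕜 E) e‖ := by
    intro f hf
    by_contra! hcon
    have h1 : ‖(f : Dual 𝕜 E)‖ ≤ 1 / θ / 1 :=
      ContinuousLinearMap.opNorm_bound_of_ball_bound one_pos _ (Dual.toStrongDual 𝕜 E f)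
        fun e he => hcon e (mem_closedBall_zero_iff.1 he)
    rw [mem_sphere_zero_iff_norm] at hf
    change ‖f‖ ≤ _ at h1
    rw [hf, div_one, le_div_iff₀ hθ0, one_mul] at h1
    exact absurd hθ h1.not_gt
  choose! p hp1 hp2 using hpt
  obtain ⟨t, ht, hcov⟩ := (isCompact_sphere (0 : V) 1).elim_nhds_subcover
    (fun f => {g : V | 1 / θ < ‖(g : Dual 𝕜 E) (p f)‖}) fun f hf => by
      have hcont : Continuous fun g : V => ‖(g : Dual 𝕜 E) (p f)‖ :=
        ((toBidual 𝕜 E (p f)).continuous.comp continuous_subtype_val).norm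
      exact (isOpen_lt continuous_const hcont).mem_nhds (hp2 f hf)
  refine ⟨insert 0 (t.image p), fun f hf => ?_⟩
  rcases eq_or_ne f 0 with rfl | hf0
  · exact ⟨0, Finset.mem_insert_self _ _, by simp, by simp⟩
  have hfn : 0 < ‖f‖ := norm_pos_iff.2 hf0
  let f' : V := ((‖f‖⁻¹ : ℝ) : 𝕜) • ⟨f, hf⟩
  have hf' : f' ∈ Metric.sphere (0 : V) 1 := by
    rw [mem_sphere_zero_iff_norm, norm_smul, RCLike.norm_ofReal, abs_of_pos (inv_pos.2 hfn)]
    exact inv_mul_cancel₀ hfn.ne'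
  obtain ⟨g, hg, hgf⟩ := Set.mem_iUnion₂.1 (hcov hf')
  refine ⟨p g, Finset.mem_insert_of_mem (Finset.mem_image_of_mem p hg), hp1 g (ht g hg), ?_⟩
  have h1 : ‖(f' : Dual 𝕜 E) (p g)‖ = ‖f‖⁻¹ * ‖f (p g)‖ := by
    have : (f' : Dual 𝕜 E) (p g) = ((‖f‖⁻¹ : ℝ) : 𝕜) * f (p g) := rfl
    rw [this, norm_mul, RCLike.norm_ofReal, abs_of_pos (inv_pos.2 hfn)]
  have h2 : 1 / θ < ‖f‖⁻¹ * ‖f (p g)‖ := by rw [← h1]; exact hgf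
  rw [div_lt_iff₀' hθ0, inv_mul_eq_div, mul_div_assoc', lt_div_iff₀ hfn, one_mul] at h2
  exact h2.le

theorem toBidual_mem_canonicalImage {E : Type*} [NormedAddCommGroup E] [NormedSpace 𝕜 E] (x : E) :
    toBidual 𝕜 E x ∈ canonicalImage 𝕜 E := ⟨x, rfl⟩

theorem norm_mul_infDist_le {E : Type*} [NormedAddCommGroup E] [NormedSpace 𝕜 E]
    (M : Submodule 𝕜 E) {y : E} (hy : y ∈ M) (a : 𝕜) (z : E) :
    ‖a‖ * Metric.infDist z M ≤ ‖y + a • z‖ := by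
  rw [← norm_mk_eq_infDist, ← norm_smul, ← Submodule.Quotient.mk_smul]
  have : (Submodule.Quotient.mk (a • z) : E ⧸ M) = Submodule.Quotient.mk (y + a • z) := by
    rw [Submodule.Quotient.mk_add, (Submodule.Quotient.mk_eq_zero M).2 hy, zero_add]
  rw [this]
  exact Submodule.Quotient.norm_mk_le M _

variable {X : Type*} [NormedAddCommGroup X] [NormedSpace 𝕜 X]

/-- `x` is asymptotically indistinguishable from `z` on functionals that almost norm the linear
combinations of `z` and of initial segments of `x`. -/
def TracksNorming (x : ℕ → X) (z : Dual 𝕜 (Dual 𝕜 X)) (θ : ℝ) (ε : ℕ → ℝ) : Prop :=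
  ∀ (m : ℕ) (c : ℕ → 𝕜) (a : 𝕜), ∃ g : Dual 𝕜 X, ‖g‖ ≤ 1 ∧
    ‖toBidual 𝕜 X (∑ i ∈ Finset.range m, c i • x i) + a • z‖ ≤
      θ * ‖(toBidual 𝕜 X (∑ i ∈ Finset.range m, c i • x i) + a • z) g‖ ∧
    ∀ j, m ≤ j → ‖g (x j) - z g‖ ≤ ε j

theorem TracksNorming.norm_add_smul_le {x : ℕ → X} {z : Dual 𝕜 (Dual 𝕜 X)} {θ : ℝ} {ε : ℕ → ℝ}
    (h : TracksNorming x z θ ε) (hθ : 0 ≤ θ) (hε : ∀ j, 0 ≤ ε j) {δ : ℝ}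
    (hδ : ∀ N, ∑ j ∈ Finset.range N, ε j ≤ δ) (c : ℕ → 𝕜) {m N : ℕ} (hmN : m ≤ N) {M : ℝ}
    (hM : ∀ j < N, ‖c j‖ ≤ M) (hM0 : 0 ≤ M) :
    ‖toBidual 𝕜 X (∑ i ∈ Finset.range m, c i • x i) + (∑ i ∈ Finset.Ico m N, c i) • z‖ ≤
      θ * (‖∑ i ∈ Finset.range N, c i • x i‖ + M * δ) := by
  obtain ⟨g, hg1, hg2, hg3⟩ := h m c (∑ i ∈ Finset.Ico m N, c i)
  refine hg2.trans (mul_le_mul_of_nonneg_left ?_ hθ)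
  have h1 : (toBidual 𝕜 X (∑ i ∈ Finset.range m, c i • x i) +
      (∑ i ∈ Finset.Ico m N, c i) • z) g =
      g (∑ i ∈ Finset.range N, c i • x i) - ∑ i ∈ Finset.Ico m N, c i * (g (x i) - z g) := by
    rw [Dual.add_apply, Dual.smul_apply, toBidual_apply, ← Finset.sum_range_add_sum_Ico _ hmN,
      map_add, map_sum g _ (Finset.Ico m N)]
    simp only [map_smul, smul_eq_mul, mul_sub, Finset.sum_sub_distrib, Finset.sum_mul]
    ring
  rw [h1]
  refine (norm_sub_le _ _).trans (add_le_add ?_ ?_)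
  · exact (g.le_norm _).trans (mul_le_of_le_one_left (norm_nonneg _) hg1)
  · calc ‖∑ i ∈ Finset.Ico m N, c i * (g (x i) - z g)‖
        ≤ ∑ i ∈ Finset.Ico m N, M * ε i := by
          refine norm_sum_le_of_le _ fun i hi => ?_
          rw [Finset.mem_Ico] at hi
          rw [norm_mul]
          exact mul_le_mul (hM i hi.2) (hg3 i hi.1) (norm_nonneg _) hM0
      _ ≤ ∑ i ∈ Finset.range N, M * ε i := by
          refine Finset.sum_le_sum_of_subset_of_nonneg (fun i hi => ?_) fun i _ _ =>
            mul_nonneg hM0 (hε i)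
          rw [Finset.mem_Ico] at hi
          exact Finset.mem_range.2 hi.2
      _ = M * ∑ i ∈ Finset.range N, ε i := by rw [Finset.mul_sum]
      _ ≤ M * δ := mul_le_mul_of_nonneg_left (hδ N) hM0

theorem TracksNorming.norm_add_smul_le' {x : ℕ → X} {z : Dual 𝕜 (Dual 𝕜 X)} {θ θ' d : ℝ}
    {ε : ℕ → ℝ} (h : TracksNorming x z θ ε) (hθ : 0 < θ) (hε : ∀ j, 0 ≤ ε j) {δ : ℝ}
    (hδ : ∀ N, ∑ j ∈ Finset.range N, ε j ≤ δ) (hd : 0 < d)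
    (hz : d ≤ Metric.infDist z (canonicalImage 𝕜 X)) (h1 : 4 * θ * δ ≤ d)
    (h2 : θ * (1 + 4 * θ * δ / d) ≤ θ') (c : ℕ → 𝕜) {m N : ℕ} (hmN : m ≤ N) :
    ‖toBidual 𝕜 X (∑ i ∈ Finset.range m, c i • x i) + (∑ i ∈ Finset.Ico m N, c i) • z‖ ≤
      θ' * ‖∑ i ∈ Finset.range N, c i • x i‖ := by
  have hδ0 : 0 ≤ δ := by simpa using hδ 0
  rcases N.eq_zero_or_pos with rfl | hN
  · obtain rfl : m = 0 := by omega
    simp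
  obtain ⟨p, hp, hmax⟩ := Finset.exists_max_image (Finset.range N) (fun j => ‖c j‖)
    ⟨0, Finset.mem_range.2 hN⟩
  rw [Finset.mem_range] at hp
  have hM : ∀ j < N, ‖c j‖ ≤ ‖c p‖ := fun j hj => hmax j (Finset.mem_range.2 hj)
  set v := ∑ i ∈ Finset.range N, c i • x i with hv
  have key : ∀ k ≤ N, ‖∑ i ∈ Finset.Ico k N, c i‖ * d ≤ θ * (‖v‖ + ‖c p‖ * δ) := fun k hk =>
    (mul_le_mul_of_nonneg_left hz (norm_nonneg _)).trans
      ((norm_mul_infDist_le _ (toBidual_mem_canonicalImage _) _ _).trans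
        (h.norm_add_smul_le hθ.le hε hδ c hk hM (norm_nonneg _)))
  have hcp : ‖c p‖ * d ≤ 2 * (θ * (‖v‖ + ‖c p‖ * δ)) := by
    have e1 := key p hp.le
    have e2 := key (p + 1) hp
    have e3 : ‖c p‖ ≤ ‖∑ i ∈ Finset.Ico p N, c i‖ + ‖∑ i ∈ Finset.Ico (p + 1) N, c i‖ := by
      have : c p = ∑ i ∈ Finset.Ico p N, c i - ∑ i ∈ Finset.Ico (p + 1) N, c i := by
        rw [Finset.sum_eq_sum_Ico_succ_bot hp, add_sub_cancel_right]
      conv_lhs => rw [this]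
      exact norm_sub_le _ _
    nlinarith
  have hcp' : ‖c p‖ ≤ 4 * θ * ‖v‖ / d := by
    rw [le_div_iff₀ hd]
    have : ‖c p‖ * (4 * θ * δ) ≤ ‖c p‖ * d := mul_le_mul_of_nonneg_left h1 (norm_nonneg _)
    linarith
  refine (h.norm_add_smul_le hθ.le hε hδ c hmN hM (norm_nonneg _)).trans ?_
  calc θ * (‖v‖ + ‖c p‖ * δ) ≤ θ * (‖v‖ + 4 * θ * ‖v‖ / d * δ) := by gcongr
    _ = θ * (1 + 4 * θ * δ / d) * ‖v‖ := by ring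
    _ ≤ θ' * ‖v‖ := mul_le_mul_of_nonneg_right h2 (norm_nonneg _)

theorem exists_tracksNorming {ι : Type*} (F : Filter ι) [F.NeBot] (u : ι → X)
    {z : Dual 𝕜 (Dual 𝕜 X)} (hz : ∀ g : Dual 𝕜 X, Tendsto (fun i => g (u i)) F (𝓝 (z g)))
    (r : ι → ι → Prop) (hr : ∀ i, ∀ᶠ j in F, r i j) {θ : ℝ} (hθ : 1 < θ) {ε : ℕ → ℝ}
    (hε : ∀ j, 0 < ε j) :
    ∃ s : ℕ → ι, (∀ m n, m < n → r (s m) (s n)) ∧ TracksNorming (fun n => u (s n)) z θ ε := by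
  classical
  let V : List ι → Submodule 𝕜 (Dual 𝕜 (Dual 𝕜 X)) := fun l =>
    Submodule.span 𝕜 ((insert z (l.map fun i => toBidual 𝕜 X (u i)).toFinset : Finset _) : Set _)
  have hV : ∀ l, FiniteDimensional 𝕜 (V l) := fun l =>
    FiniteDimensional.span_finset 𝕜 _
  choose G hG using fun l => exists_finset_norming (V l) hθ
  have hstep : ∀ l : List ι, ∃ i, (∀ k ∈ l, r k i) ∧
      ∀ l' ∈ l.tails, ∀ g ∈ G l', ‖g (u i) - z g‖ ≤ ε l.length := by
    intro l
    have e1 : ∀ᶠ i in F, ∀ k ∈ l.toFinset, r k i :=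
      (Filter.eventually_all_finset _).2 fun k _ => hr k
    have e2 : ∀ᶠ i in F, ∀ l' ∈ l.tails.toFinset, ∀ g ∈ G l', ‖g (u i) - z g‖ ≤ ε l.length := by
      refine (Filter.eventually_all_finset _).2 fun l' _ =>
        (Filter.eventually_all_finset _).2 fun g _ => ?_
      filter_upwards [(hz g).eventually (Metric.closedBall_mem_nhds (z g) (hε l.length))] with i hi
      rwa [← dist_eq_norm]
    obtain ⟨i, h1, h2⟩ := (e1.and e2).exists
    exact ⟨i, fun k hk => h1 k (List.mem_toFinset.2 hk),
      fun l' hl' => h2 l' (List.mem_toFinset.2 hl')⟩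
  choose f hf1 hf2 using hstep
  let hist : ℕ → List ι := fun n => Nat.rec [] (fun _ l => f l :: l) n
  have hist_succ : ∀ n, hist (n + 1) = f (hist n) :: hist n := fun n => rfl
  have hlen : ∀ n, (hist n).length = n := by
    intro n
    induction n with
    | zero => rfl
    | succ n ih => rw [hist_succ, List.length_cons, ih]
  have hsuf : ∀ m n, m ≤ n → hist m <:+ hist n := by
    intro m n hmn
    induction n, hmn using Nat.le_induction with
    | base => exact List.suffix_rfl
    | succ n _ ih => rw [hist_succ]; exact ih.trans (List.suffix_cons _ _)
  have hmem : ∀ m n, m < n → f (hist m) ∈ hist n := fun m n hmn =>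
    (hsuf (m + 1) n hmn).subset (by rw [hist_succ]; exact List.mem_cons_self)
  refine ⟨fun n => f (hist n), fun m n hmn => hf1 _ _ (hmem m n hmn), fun m c a => ?_⟩
  have hin : toBidual 𝕜 X (∑ i ∈ Finset.range m, c i • u (f (hist i))) + a • z ∈ V (hist m) := by
    refine add_mem ?_ (Submodule.smul_mem _ _ (Submodule.subset_span ?_))
    · rw [map_sum]
      refine sum_mem fun i hi => ?_
      rw [map_smul]
      refine Submodule.smul_mem _ _ (Submodule.subset_span ?_)
      rw [Finset.mem_coe, Finset.mem_insert, List.mem_toFinset]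
      exact Or.inr (List.mem_map.2 ⟨_, hmem i m (Finset.mem_range.1 hi), rfl⟩)
    · exact Finset.mem_coe.2 (Finset.mem_insert_self _ _)
  obtain ⟨g, hg, hg1, hg2⟩ := hG (hist m) _ hin
  refine ⟨g, hg1, hg2, fun j hj => ?_⟩
  have := hf2 (hist j) (hist m) ((List.mem_tails _ _).2 (hsuf m j hj)) g hg
  rwa [hlen] at this

/-- Selection of wide-(s) sequences near a point of the bidual outside of the space. -/
theorem exists_wide_selection {ι : Type*} (F : Filter ι) [F.NeBot] (u : ι → X)
    {z : Dual 𝕜 (Dual 𝕜 X)} (hz : ∀ g : Dual 𝕜 X, Tendsto (fun i => g (u i)) F (𝓝 (z g)))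
    (r : ι → ι → Prop) (hr : ∀ i, ∀ᶠ j in F, r i j) {d : ℝ} (hd : 0 < d)
    (hdz : d ≤ Metric.infDist z (canonicalImage 𝕜 X)) {θ : ℝ} (hθ : 1 < θ) :
    ∃ s : ℕ → ι, (∀ m n, m < n → r (s m) (s n)) ∧ ∀ (c : ℕ → 𝕜) (N m : ℕ), m ≤ N →
      ‖∑ i ∈ Finset.Ico m N, c i‖ ≤ θ / d * ‖∑ i ∈ Finset.range N, c i • u (s i)‖ ∧
      ‖∑ i ∈ Finset.range m, c i • u (s i)‖ ≤
        θ * (1 + ‖z‖ / d) * ‖∑ i ∈ Finset.range N, c i • u (s i)‖ := by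
  set η := (1 + θ) / 2 with hη
  have hη1 : 1 < η := by rw [hη]; linarith
  have hη0 : 0 < η := by linarith
  have hθη : 0 < θ - η := by rw [hη]; linarith
  set δ := d * min (1 / (4 * η)) ((θ - η) / (4 * η ^ 2)) with hδ
  have hδ0 : 0 < δ := mul_pos hd (lt_min (by positivity) (by positivity))
  have hδ1 : 4 * η * δ ≤ d := by
    calc 4 * η * δ ≤ 4 * η * (d * (1 / (4 * η))) := by
          rw [hδ]; gcongr; exact min_le_left _ _
      _ = d := by field_simp
  have hδ2 : η * (1 + 4 * η * δ / d) ≤ θ := by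
    calc η * (1 + 4 * η * δ / d) ≤ η * (1 + 4 * η * (d * ((θ - η) / (4 * η ^ 2))) / d) := by
          rw [hδ]; gcongr; exact min_le_right _ _
      _ = θ := by field_simp; ring
  let ε : ℕ → ℝ := fun n => δ / 2 * (1 / 2) ^ n
  have hε : ∀ n, 0 < ε n := fun n => by positivity
  have hsum : ∀ N, ∑ j ∈ Finset.range N, ε j ≤ δ := fun N => by
    rw [← Finset.mul_sum]
    nlinarith [sum_geometric_two_le N]
  obtain ⟨s, hs1, hs2⟩ := exists_tracksNorming F u hz r hr hη1 hε
  refine ⟨s, hs1, fun c N m hmN => ?_⟩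
  have key := hs2.norm_add_smul_le' hη0 (fun n => (hε n).le) hsum hd hdz hδ1 hδ2 c hmN
  set y := ∑ i ∈ Finset.range m, c i • u (s i)
  set a := ∑ i ∈ Finset.Ico m N, c i
  set v := ∑ i ∈ Finset.range N, c i • u (s i)
  have ha : ‖a‖ * d ≤ θ * ‖v‖ :=
    (mul_le_mul_of_nonneg_left hdz (norm_nonneg _)).trans
      ((norm_mul_infDist_le _ (toBidual_mem_canonicalImage _) _ _).trans key)
  have ha' : ‖a‖ ≤ θ / d * ‖v‖ := by
    rw [div_mul_eq_mul_div, le_div_iff₀ hd]; exact ha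
  refine ⟨ha', ?_⟩
  calc ‖y‖ = ‖(toBidual 𝕜 X y + a • z) - a • z‖ := by rw [add_sub_cancel_right, norm_toBidual]
    _ ≤ ‖toBidual 𝕜 X y + a • z‖ + ‖a • z‖ := norm_sub_le _ _
    _ ≤ θ * ‖v‖ + θ / d * ‖v‖ * ‖z‖ := by rw [norm_smul]; gcongr
    _ = _ := by ring

end Selection

section WideSequences

variable {𝕜 : Type*} [RCLike 𝕜]
variable {X : Type*} [NormedAddCommGroup X] [NormedSpace 𝕜 X]
variable {Y : Type*} [NormedAddCommGroup Y] [NormedSpace 𝕜 Y]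

theorem exists_mapsWideS_of_distBound {T : X →L[𝕜] Y} {δ : ℝ} (hδ : 0 < δ) (h : DistBound T δ)
    {lam : ℝ} (hlam : 1 < lam) : ∃ bet : ℝ, 1 < bet ∧ MapsWideS 𝕜 T lam bet := by
  have hlam0 : 0 < lam := one_pos.trans hlam
  set d := δ * (1 / (2 * lam)) with hd
  have hd0 : 0 < d := by positivity
  set R := ‖adj2 T‖ * lam with hR
  have hR0 : 0 ≤ R := by positivity
  have hbound : ∀ z : Dual 𝕜 (Dual 𝕜 X), ‖z‖ ≤ lam → ‖adj2 T z‖ ≤ R := fun z hz =>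
    ((adj2 T).le_opNorm z).trans (mul_le_mul_of_nonneg_left hz (norm_nonneg _))
  have h2d : 0 < 2 / d := by positivity
  have hRd : 0 ≤ R / d := by positivity
  refine ⟨2 + 2 / d + R / d + R, by linarith, fun x hx => ?_⟩
  obtain ⟨z, hzn, hz⟩ := exists_tendsto_dual_apply (Filter.hyperfilter ℕ)
    (fun j => toBidual 𝕜 X (x j)) (R := lam) fun j => by rw [norm_toBidual]; exact hx.norm_le j
  have hdz : d ≤ Metric.infDist (adj2 T z) (canonicalImage 𝕜 Y) :=
    (mul_le_mul_of_nonneg_left (hx.le_infDist hlam0 Nat.hyperfilter_le_atTop hz) hδ.le).trans (h z)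
  obtain ⟨φ, hφ, hsel⟩ := exists_wide_selection (Filter.hyperfilter ℕ : Filter ℕ)
    (fun j => T (x j)) (z := adj2 T z) (fun g => hz (adj T g)) (· < ·)
    (fun i => Nat.hyperfilter_le_atTop (eventually_gt_atTop i)) hd0 hdz one_lt_two
  refine ⟨φ, fun m n hmn => hφ m n hmn, isWideS_of_norm_sum_le (fun c N m hmN => ?_) (fun j => ?_)
    fun c N m hmN => ?_⟩
  · refine (hsel c N m hmN).2.trans (mul_le_mul_of_nonneg_right ?_ (norm_nonneg _))
    have : ‖adj2 T z‖ / d ≤ R / d := by gcongr; exact hbound z hzn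
    linarith
  · have : ‖adj2 T (toBidual 𝕜 X (x (φ j)))‖ ≤ R :=
      hbound _ (by rw [norm_toBidual]; exact hx.norm_le _)
    rw [adj2_toBidual, norm_toBidual] at this
    linarith
  · refine (hsel c N m hmN).1.trans (mul_le_mul_of_nonneg_right ?_ (norm_nonneg _))
    linarith

theorem infDist_smul_sub {E : Type*} [NormedAddCommGroup E] [NormedSpace 𝕜 E] (M : Submodule 𝕜 E)
    {m : E} (hm : m ∈ M) (a : 𝕜) (x : E) :
    Metric.infDist (a • (x - m)) M = ‖a‖ * Metric.infDist x M := by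
  rw [← norm_mk_eq_infDist, ← norm_mk_eq_infDist, Submodule.Quotient.mk_smul,
    Submodule.Quotient.mk_sub, (Submodule.Quotient.mk_eq_zero M).2 hm, sub_zero, norm_smul]

theorem exists_of_not_distBound {T : X →L[𝕜] Y} {δ : ℝ} (hδ : 0 < δ) (h : ¬ DistBound T δ)
    {μ : ℝ} (hμ : 1 < μ) : ∃ z : Dual 𝕜 (Dual 𝕜 X), ‖z‖ ≤ μ ∧
      Metric.infDist z (canonicalImage 𝕜 X) = 1 ∧ ∃ y, ‖adj2 T z - toBidual 𝕜 Y y‖ < δ := by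
  obtain ⟨x, hx⟩ : ∃ x : Dual 𝕜 (Dual 𝕜 X), Metric.infDist (adj2 T x) (canonicalImage 𝕜 Y) <
      δ * Metric.infDist x (canonicalImage 𝕜 X) := by
    by_contra! hcon
    exact h hcon
  set D := Metric.infDist x (canonicalImage 𝕜 X) with hD
  have hD0 : 0 < D := pos_of_mul_pos_right (Metric.infDist_nonneg.trans_lt hx) hδ.le
  have hDμ : D < μ * D := lt_mul_of_one_lt_left hD0 hμ
  rw [hD] at hDμ
  obtain ⟨_, ⟨x₀, rfl⟩, hx₀⟩ := (Metric.infDist_lt_iff ⟨0, Submodule.zero_mem _⟩).1 hDμ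
  rw [dist_eq_norm, ← hD] at hx₀
  have ha : ‖((D⁻¹ : ℝ) : 𝕜)‖ = D⁻¹ := by rw [RCLike.norm_ofReal, abs_of_pos (inv_pos.2 hD0)]
  refine ⟨((D⁻¹ : ℝ) : 𝕜) • (x - toBidual 𝕜 X x₀), ?_, ?_, ?_⟩
  · rw [norm_smul, ha, inv_mul_le_iff₀ hD0, mul_comm D]
    exact hx₀.le
  · rw [infDist_smul_sub _ (toBidual_mem_canonicalImage x₀), ha, ← hD, inv_mul_cancel₀ hD0.ne']
  · have h1 : Metric.infDist (adj2 T (((D⁻¹ : ℝ) : 𝕜) • (x - toBidual 𝕜 X x₀)))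
        (canonicalImage 𝕜 Y) < δ := by
      rw [map_smul, map_sub, adj2_toBidual,
        infDist_smul_sub _ (toBidual_mem_canonicalImage (T x₀)), ha, inv_mul_lt_iff₀ hD0,
        mul_comm D]
      exact hx
    obtain ⟨_, ⟨y, rfl⟩, hy⟩ := (Metric.infDist_lt_iff ⟨0, Submodule.zero_mem _⟩).1 h1
    exact ⟨y, by rwa [dist_eq_norm] at hy⟩

theorem exists_distBound_of_mapsWideS {T : X →L[𝕜] Y} {lam bet : ℝ} (hlam : 1 < lam)
    (hbet : 0 < bet) (h : MapsWideS 𝕜 T lam bet) : ∃ δ : ℝ, 0 < δ ∧ DistBound T δ := by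
  set δ := 1 / (2 * bet) with hδ
  have hδ0 : 0 < δ := by positivity
  refine ⟨δ, hδ0, ?_⟩
  by_contra hcon
  have hμ1 : 1 < √lam := by rw [Real.lt_sqrt zero_le_one]; simpa using hlam
  have hμ2 : √lam * √lam = lam := Real.mul_self_sqrt (by linarith)
  have hμ3 : √lam ≤ lam := by nlinarith
  obtain ⟨z, hzn, hz1, y, hy⟩ := exists_of_not_distBound hδ0 hcon hμ1
  let ι := {w : X // ‖w‖ ≤ √lam ∧ ‖T w - y‖ < δ}
  let F : Filter ι := comap (fun w (g : Dual 𝕜 X) => g w.1) (𝓝 fun g => z g)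
  have hF : F.NeBot := by
    rw [comap_neBot_iff, nhds_pi]
    intro t ht
    obtain ⟨⟨I, ε⟩, ⟨hI, hε⟩, ht⟩ :=
      (Filter.hasBasis_pi fun g : Dual 𝕜 X => Metric.nhds_basis_ball (x := z g)).mem_iff.1 ht
    obtain ⟨w, hw1, hw2, hw3⟩ := exists_norm_le_approx T hzn hy hI.toFinset
      (ε := fun g => if 0 < ε g then ε g else 1) fun g => by split_ifs <;> [assumption; exact one_pos]
    refine ⟨⟨w, hw1, hw2⟩, ht fun g hg => ?_⟩
    have := hw3 g (hI.mem_toFinset.2 hg)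
    rw [if_pos (hε g hg)] at this
    exact mem_ball_iff_norm.2 this
  have hlim : ∀ g : Dual 𝕜 X, Tendsto (fun w : ι => g w.1) F (𝓝 (z g)) := fun g =>
    tendsto_pi_nhds.1 (tendsto_comap (f := fun (w : ι) (g : Dual 𝕜 X) => g w.1)) g
  obtain ⟨s, -, hs⟩ := exists_wide_selection F (fun w => w.1) hlim (fun _ _ => True)
    (fun _ => Eventually.of_forall fun _ => trivial) one_pos hz1.ge hμ1
  have hwide : IsWideS 𝕜 lam fun n => (s n).1 := by
    refine isWideS_of_norm_sum_le (fun c N m hmN => ?_) (fun j => (s j).2.1.trans hμ3)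
      fun c N m hmN => ?_
    · refine (hs c N m hmN).2.trans (mul_le_mul_of_nonneg_right ?_ (norm_nonneg _))
      rw [div_one]
      nlinarith
    · refine (hs c N m hmN).1.trans (mul_le_mul_of_nonneg_right ?_ (norm_nonneg _))
      rwa [div_one]
  obtain ⟨φ, -, hφ⟩ := h _ hwide
  have h1 := hφ.norm_sum_le 1 1 le_rfl fun j => if j = 1 then 1 else -1
  have h2 : ∑ j ∈ Finset.range (1 + 1), (if j = 1 then (1 : 𝕜) else -1) • T (s (φ j)).1 =
      (T (s (φ 1)).1 - y) - (T (s (φ 0)).1 - y) := by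
    rw [Finset.sum_range_succ, Finset.sum_range_one]
    simp only [zero_ne_one, if_false, if_true, one_smul, neg_smul]
    abel
  rw [h2, Finset.Icc_self, Finset.sum_singleton, if_pos rfl, norm_one] at h1
  have h3 : ‖(T (s (φ 1)).1 - y) - (T (s (φ 0)).1 - y)‖ < δ + δ :=
    (norm_sub_le _ _).trans_lt (add_lt_add (s (φ 1)).2.2 (s (φ 0)).2.2)
  have h4 : bet * (δ + δ) = 1 := by rw [hδ]; field_simp; norm_num
  have := mul_lt_mul_of_pos_left h3 hbet
  linarith

end WideSequences

end StronglyTauberian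

end

theorem theorem21 {𝕜 : Type*} [RCLike 𝕜]
    {X : Type*} [NormedAddCommGroup X] [NormedSpace 𝕜 X] [CompleteSpace X]
    {Y : Type*} [NormedAddCommGroup Y] [NormedSpace 𝕜 Y] [CompleteSpace Y]
    (T : X →L[𝕜] Y) :
    List.TFAE [
      StronglyTauberian.IsStronglyTauberian T,
      ∃ δ : ℝ, 0 < δ ∧ ∀ x : StronglyTauberian.Dual 𝕜 (StronglyTauberian.Dual 𝕜 X),
        δ * Metric.infDist x (StronglyTauberian.canonicalImage 𝕜 X) ≤
          Metric.infDist (StronglyTauberian.adj2 T x) (StronglyTauberian.canonicalImage 𝕜 Y),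
      StronglyTauberian.adj3 T ''
          (StronglyTauberian.annihilator 𝕜 (StronglyTauberian.canonicalImage 𝕜 Y)) =
        StronglyTauberian.annihilator 𝕜 (StronglyTauberian.canonicalImage 𝕜 X),
      StronglyTauberian.IsIntoIsomorphism (StronglyTauberian.adj4 T ∘L
        (StronglyTauberian.annihilator 𝕜
          (StronglyTauberian.canonicalImage 𝕜 (StronglyTauberian.Dual 𝕜 X))).subtypeL),
      StronglyTauberian.IsStronglyTauberian (StronglyTauberian.adj2 T),
      ∀ lam : ℝ, 1 < lam → ∃ bet : ℝ, 1 < bet ∧ StronglyTauberian.MapsWideS 𝕜 T lam bet,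
      ∃ lam : ℝ, 1 < lam ∧ ∃ bet : ℝ, 1 < bet ∧ StronglyTauberian.MapsWideS 𝕜 T lam bet] := by
  tfae_have 1 ↔ 2 := StronglyTauberian.isStronglyTauberian_iff T
  tfae_have 2 → 3 := fun ⟨_, hδ, h⟩ =>
    StronglyTauberian.adj3_image_annihilator_of_distBound hδ h
  tfae_have 3 → 4 := StronglyTauberian.isIntoIsomorphism_adj4_of_adj3_image
  tfae_have 4 → 2 := StronglyTauberian.exists_distBound_of_isIntoIsomorphism_adj4
  tfae_have 5 ↔ 4 := StronglyTauberian.isStronglyTauberian_adj2_iff T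
  tfae_have 2 → 6 := fun ⟨_, hδ, h⟩ _ hlam =>
    StronglyTauberian.exists_mapsWideS_of_distBound hδ h hlam
  tfae_have 6 → 7 := fun h => ⟨2, one_lt_two, h 2 one_lt_two⟩
  tfae_have 7 → 2 := fun ⟨_, hlam, _, hbet, h⟩ =>
    StronglyTauberian.exists_distBound_of_mapsWideS hlam (one_pos.trans hbet) h
  tfae_finish
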